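/- **Setting.** Fix $p$ and consider the linear model $y_i=\mathbf x_i'\beta+\epsilon_i$, $i=1,2,\dots$, with non-random design vectors $\mathbf x_i\in\mathbb R^p$, parameter $\beta\in\mathbb R^p$ and i.i.d. errors $\epsilon_i$. Let $G_1^*,G_2^*,\dots$ be i.i.d., non-negative, non-degenerate random variables (the perturbing quantities), and let $\psi:\mathbb R\to\mathbb R$ be a score function. Let $\bar\beta_n$ be the M-estimator of $\beta$: a measurable function of $(y_1,\dots,y_n)$ such that for every $r>0$, with probability tending to $1$, it solves $$\sum_{i=1}^n \mathbf x_i\,\psi(y_i-\mathbf x_i't)=0$$ and either is the only solution or satisfies $\|\bar\beta_n-\beta\|<r$ (i.e. $\bar\beta_n$ is the solution, and the consistent one where there are several). The perturbed score equation is $$\sum_{i=1}^n \mathbf x_i\,\psi(y_i-\mathbf x_i't)\,G_i^*=0 .\tag{2.1}$$ $\mathbf P_*$ is the conditional probability given $(\epsilon_1,\dots,\epsilon_n)$, and $\|\cdot\|$ is the Euclidean norm. Put $\mathbf D_n=(\sum_{i\le n}\mathbf x_i\mathbf x_i')^{1/2}$, $\mathbf A_n=n^{-1}\mathbf D_n^2$,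 $\mathbf d_i=\mathbf D_n^{-1}\mathbf x_i$, $\mathbf z_i=(x_{ij}x_{ik})_{1\le j\le k\le p}$, $\mathbf v_i=(\mathbf x_i'\psi(\epsilon_i),\mathbf z_i'\psi'(\epsilon_i))'$. Let $\mathbf L$ be a non-singular matrix with $\mathbf L(\sum_{i\le n}\mathbf z_i\mathbf z_i')\mathbf L'=\begin{pmatrix}\mathbf I_r&0\\0&0\end{pmatrix}$, where $r$ is the rank of $\sum_{i\le n}\mathbf z_i\mathbf z_i'$, and let $\tilde{\mathbf z}_i=\mathbf L_1\mathbf z_i$, where $\mathbf L_1$ consists of the first $r$ rows of $\mathbf L$. **Assumptions.** * (A.1) $\psi$ is twice differentiable and, for some $0<2\alpha\le 1$ and some $K$, $|\psi''(u)-\psi''(v)|\le K|u-v|^\alpha$ for all $u,v$. * (A.2) (i) $\mathbf A_n\to\mathbf A_1$ for a positive definite matrix $\mathbf A_1$; (ii) $\mathbf E\big(n^{-1}\sum_{i\le n}\mathbf v_i\mathbf v_i'\big)\to\mathbf A_2$ for a non-singular matrix $\mathbf A_2$; (iii) $n^{\alpha/2}\big(\sum_{i\le n}\|\mathbf d_i\|^{6+2\alpha}\big)^{1/2}+\sum_{i\le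 n}\|\tilde{\mathbf z}_i\|^4=O(n^{-1})$. * (A.3) (i) $\mathbf E\psi(\epsilon_1)=0$ and $\sigma^2=\mathbf E\psi^2(\epsilon_1)/(\mathbf E\psi'(\epsilon_1))^2\in(0,\infty)$; (ii) $\mathbf E|\psi(\epsilon_1)|^4+\mathbf E|\psi'(\epsilon_1)|^4+\mathbf E|\psi''(\epsilon_1)|^2<\infty$. * (A.4) The sequences $(G_i^*)_{i\ge1}$ and $(\epsilon_i)_{i\ge1}$ are independent. * (A.5)(i) $\mathbf E G_1^{*3}<\infty$. **Proposition 4.1.** Under (A.1)–(A.4) and (A.5)(i) there are a constant $C_1>0$, Borel sets $\mathbf Q_{1n}\subseteq\mathbb R^n$ with $\mathbf P\big((\epsilon_1,\dots,\epsilon_n)\in\mathbf Q_{1n}\big)\to1$, a sequence $\delta_n\to0$, and statistics $\beta_n^*$ (measurable functions of $(y_1,\dots,y_n,G_1^*,\dots,G_n^*)$) such that for all $n\ge C_1$, given $(\epsilon_1,\dots,\epsilon_n)\in\mathbf Q_{1n}$, $$\mathbf P_*\Big(\beta_n^*\text{ solves (2.1) and }\|\beta_n^*-\bar\beta_n\|\le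 C_1 n^{-1/2}(\log n)^{1/2}\Big)\ \ge\ 1-\delta_n n^{-1/2}.$$ -/

import Mathlib

open MeasureTheory ProbabilityTheory Filter Asymptotics
open scoped Topology

noncomputable section

namespace PerturbationBootstrap

/-- `p`-dimensional Euclidean space, where the design vectors and the parameters live. -/
abbrev Vec (p : ℕ) : Type := EuclideanSpace ℝ (Fin p)

/-- The index pairs `(j, k)` with `j ≤ k`; there are `q = p (p + 1) / 2` of them. -/
abbrev UpperPair (p : ℕ) : Type := {jk : Fin p × Fin p // jk.1 ≤ jk.2}

/-- The vector `z = (x_j x_k)_{j ≤ k}` of the distinct second order products of the coordinates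
of `x`. -/
def zVec {p : ℕ} (x : Vec p) : UpperPair p → ℝ := fun jk => x jk.1.1 * x jk.1.2

/-- `∑_{i < n} x_i x_i'`, the square of the matrix `D_n`. -/
def gram {p : ℕ} (x : ℕ → Vec p) (n : ℕ) : Matrix (Fin p) (Fin p) ℝ :=
  ∑ i ∈ Finset.range n, Matrix.vecMulVec (x i).ofLp (x i).ofLp

/-- `A_n = n⁻¹ ∑_{i < n} x_i x_i'`. -/
def designAverage {p : ℕ} (x : ℕ → Vec p) (n : ℕ) : Matrix (Fin p) (Fin p) ℝ :=
  (n : ℝ)⁻¹ • gram x n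

section
open scoped MatrixOrder

/-- `D_n = (∑_{i < n} x_i x_i')^{1/2}`, the positive semidefinite square root. -/
def rootGram {p : ℕ} (x : ℕ → Vec p) (n : ℕ) : Matrix (Fin p) (Fin p) ℝ :=
  CFC.sqrt (gram x n)

end

/-- The standardized design vector `d_i = D_n⁻¹ x_i` (at sample size `n`). -/
def dVec {p : ℕ} (x : ℕ → Vec p) (n i : ℕ) : Vec p :=
  WithLp.toLp 2 (Matrix.mulVec (rootGram x n)⁻¹ (x i).ofLp)

/-- `∑_{i < n} z_i z_i'`. -/
def zGram {p : ℕ} (x : ℕ → Vec p) (n : ℕ) : Matrix (UpperPair p) (UpperPair p) ℝ :=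
  ∑ i ∈ Finset.range n, Matrix.vecMulVec (zVec (x i)) (zVec (x i))

/-- `L S L'` is the canonical form of `S`: a diagonal matrix whose diagonal entries are `1` at the
places in `J` and `0` elsewhere, with `L` non-singular. (The size of `J` is then the rank of `S`.) -/
def IsCanonicalReduction {q : Type} [Fintype q] [DecidableEq q]
    (S L : Matrix q q ℝ) (J : Finset q) : Prop :=
  IsUnit L.det ∧ L * S * L.transpose = Matrix.diagonal (fun j => if j ∈ J then (1 : ℝ) else 0)

/-- The vector `z̃ = L₁ z`, where `L₁` consists of the rows of `L` in `J`. -/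
def zTilde {q : Type} [Fintype q] (L : Matrix q q ℝ) (J : Finset q) (z : q → ℝ) :
    EuclideanSpace ℝ J :=
  WithLp.toLp 2 (fun j => Matrix.mulVec L z j.1)

/-- The stacked vector `v = (x' a, z' b)'`, used with `a = ψ(ε)` and `b = ψ'(ε)`. -/
def vVec {p : ℕ} (x : Vec p) (a b : ℝ) : Fin p ⊕ UpperPair p → ℝ :=
  Sum.elim (fun j => x j * a) (fun jk => zVec x jk * b)

/-- The matrix `E (n⁻¹ ∑_{i < n} v_i v_i')`, the expectation being taken entrywise. -/
def vSecondMoment {Ω : Type*} [MeasurableSpace Ω] (P : Measure Ω) {p : ℕ} (x : ℕ → Vec p)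
    (ψ : ℝ → ℝ) (ε : ℕ → Ω → ℝ) (n : ℕ) :
    Matrix (Fin p ⊕ UpperPair p) (Fin p ⊕ UpperPair p) ℝ :=
  Matrix.of fun r s => ∫ ω, (n : ℝ)⁻¹ * ∑ i ∈ Finset.range n,
    vVec (x i) (ψ (ε i ω)) (deriv ψ (ε i ω)) r * vVec (x i) (ψ (ε i ω)) (deriv ψ (ε i ω)) s ∂P

/-- `ψ` is twice differentiable and `ψ''` satisfies a Lipschitz condition of order `α`. -/
def SmoothScore (ψ : ℝ → ℝ) (α : ℝ) : Prop :=
  Differentiable ℝ ψ ∧ Differentiable ℝ (deriv ψ) ∧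
    ∃ K : ℝ, ∀ u v : ℝ, |deriv (deriv ψ) u - deriv (deriv ψ) v| ≤ K * |u - v| ^ α

/-- The regularity conditions on the design vectors. -/
structure DesignConditions {Ω : Type*} [MeasurableSpace Ω] (P : Measure Ω) {p : ℕ}
    (x : ℕ → Vec p) (ψ : ℝ → ℝ) (ε : ℕ → Ω → ℝ) (α : ℝ) : Prop where
  /-- `A_n` converges to a positive definite matrix. -/
  average : ∃ A₁ : Matrix (Fin p) (Fin p) ℝ, A₁.PosDef ∧
    Tendsto (designAverage x) atTop (𝓝 A₁)
  /-- `E (n⁻¹ ∑ v_i v_i')` converges to a non-singular matrix. -/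
  secondMoment : ∃ A₂ : Matrix (Fin p ⊕ UpperPair p) (Fin p ⊕ UpperPair p) ℝ, IsUnit A₂.det ∧
    Tendsto (vSecondMoment P x ψ ε) atTop (𝓝 A₂)
  /-- `n^{α/2} (∑ ‖d_i‖^{6+2α})^{1/2} + ∑ ‖z̃_i‖⁴ = O(n⁻¹)`. (The norms `‖z̃_i‖` do not depend on
  the choice of the canonical reductions.) -/
  growth : ∃ (L : ℕ → Matrix (UpperPair p) (UpperPair p) ℝ) (J : ℕ → Finset (UpperPair p)),
    (∀ n, IsCanonicalReduction (zGram x n) (L n) (J n)) ∧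
    (fun n : ℕ => (n : ℝ) ^ (α / 2) *
        (∑ i ∈ Finset.range n, ‖dVec x n i‖ ^ (6 + 2 * α)) ^ (1 / 2 : ℝ) +
        ∑ i ∈ Finset.range n, ‖zTilde (L n) (J n) (zVec (x i))‖ ^ 4)
      =O[atTop] (fun n : ℕ => (n : ℝ)⁻¹)

/-- The moment conditions on one error variable `e` through the score function `ψ`. -/
structure ErrorMoments {Ω : Type*} [MeasurableSpace Ω] (P : Measure Ω) (ψ : ℝ → ℝ)
    (e : Ω → ℝ) : Prop where
  centered : ∫ ω, ψ (e ω) ∂P = 0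
  /-- The asymptotic variance `σ² = E ψ²(ε₁) / (E ψ'(ε₁))²` lies in `(0, ∞)`; in particular
  `E ψ'(ε₁) ≠ 0`. -/
  variance_pos : 0 < (∫ ω, ψ (e ω) ^ 2 ∂P) / (∫ ω, deriv ψ (e ω) ∂P) ^ 2
  moment_score : Integrable (fun ω => |ψ (e ω)| ^ 4) P
  moment_deriv : Integrable (fun ω => |deriv ψ (e ω)| ^ 4) P
  moment_deriv2 : Integrable (fun ω => |deriv (deriv ψ) (e ω)| ^ 2) P

/-- The sequence `X₀, X₁, …` is independent and identically distributed. -/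
def IsIID {Ω : Type*} [MeasurableSpace Ω] (P : Measure Ω) (X : ℕ → Ω → ℝ) : Prop :=
  (∀ i, Measurable (X i)) ∧ iIndepFun X P ∧ ∀ i, IdentDistrib (X i) (X 0) P P

/-- The first `n` terms of a sequence of random variables, as a random vector. -/
def firstN {Ω : Type*} (X : ℕ → Ω → ℝ) (n : ℕ) (ω : Ω) : Fin n → ℝ := fun i => X i ω

/-- The responses `y_i = x_i' β + e_i`, `i < n`, of the linear model. -/
def responses {p : ℕ} (x : ℕ → Vec p) (β : Vec p) {n : ℕ} (e : Fin n → ℝ) : Fin n → ℝ :=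
  fun i => inner ℝ (x i) β + e i

/-- `t` solves the score equation `∑_{i < n} x_i ψ(y_i - x_i' t) = 0`. -/
def SolvesScore {p : ℕ} (x : ℕ → Vec p) (ψ : ℝ → ℝ) {n : ℕ} (y : Fin n → ℝ) (t : Vec p) : Prop :=
  ∑ i : Fin n, ψ (y i - inner ℝ (x i) t) • x i = 0

/-- `t` solves the perturbed score equation `∑_{i < n} x_i ψ(y_i - x_i' t) g_i = 0`. -/
def SolvesPerturbedScore {p : ℕ} (x : ℕ → Vec p) (ψ : ℝ → ℝ) {n : ℕ} (y g : Fin n → ℝ)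
    (t : Vec p) : Prop :=
  ∑ i : Fin n, (ψ (y i - inner ℝ (x i) t) * g i) • x i = 0

/-- `bbar n`, a statistic of the responses `y₁, …, y_n`, is the M-estimator of `β` with score
function `ψ`: with probability tending to one it solves the score equation and, should there be
several solutions, it is the consistent one. (The failure events are required to have small outer
measure, so no measurability of uniqueness is presupposed.) -/
def IsMEstimator {Ω : Type*} [MeasurableSpace Ω] (P : Measure Ω) {p : ℕ} (x : ℕ → Vec p)
    (ψ : ℝ → ℝ) (β : Vec p) (ε : ℕ → Ω → ℝ) (bbar : (n : ℕ) → (Fin n → ℝ) → Vec p) : Prop :=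
  (∀ n, Measurable (bbar n)) ∧
  ∀ r : ℝ, 0 < r → Tendsto (fun n => P {ω |
    ¬ (SolvesScore x ψ (responses x β (firstN ε n ω)) (bbar n (responses x β (firstN ε n ω))) ∧
      ((∀ t, SolvesScore x ψ (responses x β (firstN ε n ω)) t →
          t = bbar n (responses x β (firstN ε n ω))) ∨
        ‖bbar n (responses x β (firstN ε n ω)) - β‖ < r))}) atTop (𝓝 0)

/-- The bootstrap probability `P_*` given the errors `ε₁ = e₁, …, ε_n = e_n`: the conditional
distribution of the perturbing quantities `G₁, …, G_n` given the errors. -/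
def bootstrapLaw {Ω : Type*} [MeasurableSpace Ω] (P : Measure Ω) [IsFiniteMeasure P]
    (ε G : ℕ → Ω → ℝ) (n : ℕ) (e : Fin n → ℝ) : Measure (Fin n → ℝ) :=
  condDistrib (firstN G n) (firstN ε n) P e

end PerturbationBootstrap

end

noncomputable section

namespace PerturbationBootstrap

/-! ### Tail bounds for weighted sums of i.i.d. variables, and the bootstrap law -/

section Probability

variable {Ω : Type*} [MeasurableSpace Ω] {P : Measure Ω}

/-! Near `β` the weighted score is a small perturbation of an affine map with linear part `-n A`,
where `A` is the limiting design matrix times `E ψ'(ε₁)`, and also times `E G₁` for the perturbed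
equation. If the Jacobian error and the second order remainder are controlled at scale `n`
(`NearlyLinear`), the simplified Newton map with the fixed matrix `A⁻¹` halves distances on a small
ball around `β`. Once the score at `β` is small compared with `n`, this map preserves the ball. So
the ball contains a root, and every root in it lies within a constant times `n⁻¹ ‖score at β‖` of
`β` (`NearlyLinear.exists_root`). Unit weights place the M-estimator, and the weights `G` a
bootstrap root, at distance `O(√(log n / n))` from `β`; the triangle inequality compares the two.

The probability enters at two levels. The errors need only be typical with probability tending to
one, for which Chebyshev and Markov suffice (`negligible_not_typicalErrors`). Given typical errors,
the failure probability over `G` must be `o(n^{-1/2})` (`negligible_not_nearlyLinear`). Jacobian and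
remainder are compared at scale `n`, where Chebyshev gives order `log n / n`. The score has to be
controlled at scale `√(n log n)`, where Chebyshev would give no better than order `1 / log n`. There
a Fuk–Nagaev argument uses the third moment of `G`: one large summand has probability of order `(n
log n)^{-1/2}`, and the truncated sum has a Chernoff tail of order `1/n`
(`IsIID.negligible_moderate_deviation`).

Taking the bootstrap estimator to be the limit of Newton iterates started at the M-estimator makes
it measurable without a selection argument. Independence identifies the conditional law of `G` with
its unconditional law off a null set of errors, which is removed from the good set. -/

theorem IsIID.identDistrib_comp {X : ℕ → Ω → ℝ} (hX : IsIID P X) {f : ℝ → ℝ}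
    (hf : Measurable f) (i : ℕ) :
    IdentDistrib (fun ω => f (X i ω)) (fun ω => f (X 0 ω)) P P :=
  (hX.2.2 i).comp hf

/-- Chebyshev's inequality for a weighted sum of functions of i.i.d. variables. -/
theorem IsIID.chebyshev_weighted [IsProbabilityMeasure P] {X : ℕ → Ω → ℝ} (hX : IsIID P X)
    {f : ℝ → ℝ} (hf : Measurable f) (hf2 : MemLp (fun ω => f (X 0 ω)) 2 P) {n : ℕ}
    (a : Fin n → ℝ) {τ : ℝ} (hτ : 0 < τ) :
    P.real {ω | τ ≤ |∑ i : Fin n, a i * (f (X i ω) - ∫ ω, f (X 0 ω) ∂P)|} ≤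
      variance (fun ω => f (X 0 ω)) P * (∑ i, a i ^ 2) / τ ^ 2 := by
  have hmem : ∀ i : ℕ, MemLp (fun ω => f (X i ω)) 2 P := fun i =>
    (hX.identDistrib_comp hf i).symm.memLp_snd hf2
  set S : Ω → ℝ := ∑ i : Fin n, fun ω => a i * f (X i ω) with hS
  have hSmem : MemLp S 2 P := memLp_finsetSum' _ fun (i : Fin n) _ => (hmem i).const_mul (a i)
  have hind : iIndepFun (fun (i : Fin n) ω => a i * f (X i ω)) P :=
    (hX.2.1.precomp Fin.val_injective).comp (fun i x => a i * f x) fun i => hf.const_mul _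
  have hvar : variance S P = variance (fun ω => f (X 0 ω)) P * ∑ i, a i ^ 2 := by
    rw [hS, IndepFun.variance_sum (fun (i : Fin n) _ => (hmem i).const_mul (a i))
      (fun i _ j _ hij => hind.indepFun hij), Finset.mul_sum]
    refine Finset.sum_congr rfl fun i _ => ?_
    rw [variance_const_mul, (hX.identDistrib_comp hf i).variance_eq, mul_comm]
  have hmean : P[S] = ∑ i, a i * ∫ ω, f (X 0 ω) ∂P := by
    simp only [hS, Finset.sum_apply]
    rw [integral_finsetSum _ fun (i : Fin n) _ => ((hmem i).const_mul (a i)).integrable one_le_two]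
    refine Finset.sum_congr rfl fun i _ => ?_
    rw [integral_const_mul, (hX.identDistrib_comp hf i).integral_eq]
  have hset : {ω | τ ≤ |∑ i : Fin n, a i * (f (X i ω) - ∫ ω, f (X 0 ω) ∂P)|}
      = {ω | τ ≤ |S ω - P[S]|} := by
    ext ω
    rw [hmean]
    simp only [hS, Finset.sum_apply, mul_sub, Finset.sum_sub_distrib]
  rw [hset, ← hvar]
  exact ENNReal.toReal_le_of_le_ofReal (div_nonneg (variance_nonneg _ _) (sq_nonneg _))
    (meas_ge_le_variance_div_sq hSmem hτ)

/-- Markov's inequality for a weighted sum of functions of i.i.d. variables. -/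
theorem IsIID.markov_weighted [IsProbabilityMeasure P] {X : ℕ → Ω → ℝ} (hX : IsIID P X)
    {f : ℝ → ℝ} (hf : Measurable f) (hf0 : ∀ u, 0 ≤ f u)
    (hfint : Integrable (fun ω => f (X 0 ω)) P) {n : ℕ}
    {b : Fin n → ℝ} (hb : ∀ i, 0 ≤ b i) {τ : ℝ} (hτ : 0 < τ) :
    P.real {ω | τ ≤ ∑ i : Fin n, b i * f (X i ω)} ≤
      (∑ i, b i) * (∫ ω, f (X 0 ω) ∂P) / τ := by
  have hint : ∀ i : ℕ, Integrable (fun ω => f (X i ω)) P := fun i =>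
    (hX.identDistrib_comp hf i).symm.integrable_snd hfint
  have h := mul_meas_ge_le_integral_of_nonneg (μ := P)
    (f := fun ω => ∑ i : Fin n, b i * f (X i ω))
    (ae_of_all _ fun ω => Finset.sum_nonneg fun i _ => mul_nonneg (hb i) (hf0 _))
    (integrable_finsetSum _ fun i _ => (hint i).const_mul _) τ
  rw [integral_finsetSum _ fun (i : Fin n) _ => (hint i).const_mul (b i)] at h
  rw [le_div_iff₀' hτ, Finset.sum_mul]
  refine h.trans_eq (Finset.sum_congr rfl fun i _ => ?_)
  rw [integral_const_mul, (hX.identDistrib_comp hf i).integral_eq]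

/-- For `u ≤ 0` no cubic term is needed, because `(1 + u + u²/2)(1 - u + u²/2) = 1 + u⁴/4 ≥ 1` and
the second factor is at most `exp (-u)`. For `u > 1` the cubic term alone dominates. The bound `v`
stays separate from `u` so that a truncation level gives one constant for all outcomes. -/
theorem exp_le_quadratic_add_cubic {u v : ℝ} (huv : u ≤ v) :
    Real.exp u ≤ 1 + u + u ^ 2 / 2 + |u| ^ 3 * Real.exp v := by
  rcases le_or_gt u 0 with hu | hu
  · have h := Real.quadratic_le_exp_of_nonneg (neg_nonneg.2 hu)
    have h1 : Real.exp u * Real.exp (-u) = 1 := by rw [← Real.exp_add]; simp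
    have h2 : 0 ≤ |u| ^ 3 * Real.exp v := by positivity
    have h3 : 0 < 1 + -u + (-u) ^ 2 / 2 := by nlinarith [sq_nonneg u]
    have h4 : Real.exp u * (1 + -u + (-u) ^ 2 / 2) ≤ 1 := by
      calc _ ≤ Real.exp u * Real.exp (-u) := by gcongr
        _ = 1 := h1
    have h5 : (1 + u + u ^ 2 / 2) * (1 + -u + (-u) ^ 2 / 2) = 1 + u ^ 4 / 4 := by ring
    have h6 : Real.exp u ≤ 1 + u + u ^ 2 / 2 := by
      refine le_of_mul_le_mul_right (h4.trans ?_) h3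
      rw [h5]
      have : 0 ≤ u ^ 4 := by positivity
      linarith
    linarith
  · rw [abs_of_pos hu]
    have hv : Real.exp u ≤ Real.exp v := Real.exp_le_exp.2 huv
    have h1 : u ^ 3 * Real.exp u ≤ u ^ 3 * Real.exp v := by gcongr
    rcases le_or_gt u 1 with hu1 | hu1
    · have h := Real.exp_bound' hu.le hu1 (n := 3) (by norm_num)
      norm_num [Finset.sum_range_succ, Nat.factorial] at h
      have h2 : u ^ 3 * 1 ≤ u ^ 3 * Real.exp u := by
        gcongr; exact Real.one_le_exp hu.le
      have : 0 < u ^ 3 := by positivity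
      linarith
    · have h2 : 1 * Real.exp u ≤ u ^ 3 * Real.exp u := by
        gcongr; exact one_le_pow₀ hu1.le
      nlinarith

/-- The contribution of one truncated summand to the exponential moment. -/
theorem integral_exp_truncated_le [IsProbabilityMeasure P] {Z : Ω → ℝ} (hZ : Measurable Z)
    (hZ3 : Integrable (fun ω => |Z ω| ^ 3) P) (hZ2 : Integrable (fun ω => Z ω ^ 2) P)
    (hZ1 : Integrable Z P) (hmean : ∫ ω, Z ω ∂P = 0) {t M : ℝ} (ht : 0 ≤ t) (hM : 0 ≤ M) :
    Integrable (fun ω => Real.exp (t * (if Z ω ≤ M then Z ω else 0))) P ∧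
    mgf (fun ω => if Z ω ≤ M then Z ω else 0) P t ≤
      Real.exp (t ^ 2 / 2 * ∫ ω, Z ω ^ 2 ∂P +
        t ^ 3 * Real.exp (t * M) * ∫ ω, |Z ω| ^ 3 ∂P) := by
  have hmeas : Measurable fun ω => if Z ω ≤ M then Z ω else 0 :=
    Measurable.ite (hZ measurableSet_Iic) hZ measurable_const
  have hbdd : ∀ ω, t * (if Z ω ≤ M then Z ω else 0) ≤ t * M := fun ω => by
    gcongr; split_ifs with h <;> assumption
  have hint : Integrable (fun ω => Real.exp (t * (if Z ω ≤ M then Z ω else 0))) P := by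
    refine Integrable.of_bound (C := Real.exp (t * M)) (by fun_prop) (ae_of_all _ fun ω => ?_)
    rw [Real.norm_eq_abs, abs_of_pos (Real.exp_pos _)]
    exact Real.exp_le_exp.2 (hbdd ω)
  refine ⟨hint, ?_⟩
  -- Where `Z` exceeds `M` the left side is 1 and every term on the right is nonnegative. The bound
  -- can therefore involve the untruncated `Z`, whose mean is zero, and no recentring after
  -- truncation is needed.
  have hptw : ∀ ω, Real.exp (t * (if Z ω ≤ M then Z ω else 0)) ≤
      1 + t * Z ω + t ^ 2 / 2 * Z ω ^ 2 + t ^ 3 * Real.exp (t * M) * |Z ω| ^ 3 := fun ω => by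
    split_ifs with h
    · have := exp_le_quadratic_add_cubic (u := t * Z ω) (v := t * M) (by gcongr)
      rw [abs_mul, abs_of_nonneg ht] at this
      linarith
    · rw [mul_zero, Real.exp_zero]
      have : 0 ≤ Z ω := hM.trans (not_le.1 h).le
      have : 0 ≤ t * Z ω := mul_nonneg ht this
      have : 0 ≤ t ^ 2 / 2 * Z ω ^ 2 := by positivity
      have : 0 ≤ t ^ 3 * Real.exp (t * M) * |Z ω| ^ 3 := by positivity
      linarith
  calc mgf (fun ω => if Z ω ≤ M then Z ω else 0) P t
      ≤ ∫ ω, (1 + t * Z ω + t ^ 2 / 2 * Z ω ^ 2 + t ^ 3 * Real.exp (t * M) * |Z ω| ^ 3) ∂P :=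
        integral_mono hint ((((integrable_const _).add (hZ1.const_mul _)).add
          (hZ2.const_mul _)).add (hZ3.const_mul _)) hptw
    _ = 1 + (t ^ 2 / 2 * ∫ ω, Z ω ^ 2 ∂P + t ^ 3 * Real.exp (t * M) * ∫ ω, |Z ω| ^ 3 ∂P) := by
        rw [integral_add (by fun_prop) (hZ3.const_mul _), integral_add (by fun_prop)
          (hZ2.const_mul _), integral_add (integrable_const _) (hZ1.const_mul _)]
        simp only [integral_const_mul, hmean]
        simp
        ring
    _ ≤ _ := by rw [add_comm]; exact Real.add_one_le_exp _

/-- An inequality of Fuk–Nagaev type for sums of independent centred variables with third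
moments. -/
theorem fuk_nagaev_third_moment [IsProbabilityMeasure P] {n : ℕ} {Z : Fin n → Ω → ℝ}
    (hZ : ∀ i, Measurable (Z i)) (hind : iIndepFun Z P)
    (hZ3 : ∀ i, Integrable (fun ω => |Z i ω| ^ 3) P)
    (hZ2 : ∀ i, Integrable (fun ω => Z i ω ^ 2) P)
    (hZ1 : ∀ i, Integrable (Z i) P) (hmean : ∀ i, ∫ ω, Z i ω ∂P = 0)
    {s t M : ℝ} (ht : 0 ≤ t) (hM : 0 < M) :
    P.real {ω | s ≤ ∑ i, Z i ω} ≤ (∑ i, ∫ ω, |Z i ω| ^ 3 ∂P) / M ^ 3 +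
      Real.exp (-t * s + (t ^ 2 / 2 * (∑ i, ∫ ω, Z i ω ^ 2 ∂P) +
        t ^ 3 * Real.exp (t * M) * ∑ i, ∫ ω, |Z i ω| ^ 3 ∂P)) := by
  set φ : ℝ → ℝ := fun z => if z ≤ M then z else 0 with hφ
  have hφm : Measurable φ := Measurable.ite measurableSet_Iic measurable_id measurable_const
  set Y : Fin n → Ω → ℝ := fun i ω => φ (Z i ω) with hY
  have hYm : ∀ i, Measurable (Y i) := fun i => hφm.comp (hZ i)
  have hYind : iIndepFun Y P := hind.comp (fun _ => φ) fun _ => hφm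
  have hkey := fun i => integral_exp_truncated_le (hZ i) (hZ3 i) (hZ2 i) (hZ1 i) (hmean i) ht hM.le
  have hsub : {ω | s ≤ ∑ i, Z i ω} ⊆
      (⋃ i, {ω | M ^ 3 ≤ |Z i ω| ^ 3}) ∪ {ω | s ≤ (∑ i, Y i) ω} := by
    intro ω hω
    by_cases h : ∃ i, M < Z i ω
    · obtain ⟨i, hi⟩ := h
      refine Or.inl (Set.mem_iUnion.2 ⟨i, ?_⟩)
      show M ^ 3 ≤ |Z i ω| ^ 3
      gcongr
      exact hi.le.trans (le_abs_self _)
    · push Not at h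
      refine Or.inr ?_
      show s ≤ (∑ i, Y i) ω
      rw [Finset.sum_apply]
      refine le_of_le_of_eq (show s ≤ ∑ i, Z i ω from hω) (Finset.sum_congr rfl fun i _ => ?_)
      simp [hY, hφ, h i]
  refine (measureReal_mono hsub).trans ((measureReal_union_le _ _).trans (add_le_add ?_ ?_))
  · refine (measureReal_iUnion_fintype_le _).trans ?_
    rw [Finset.sum_div]
    refine Finset.sum_le_sum fun i _ => ?_
    rw [le_div_iff₀' (by positivity)]
    exact mul_meas_ge_le_integral_of_nonneg (ae_of_all _ fun ω => by positivity) (hZ3 i) _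
  · refine (measure_ge_le_exp_mul_mgf s ht
      (hYind.integrable_exp_mul_sum hYm fun i _ => (hkey i).1)).trans ?_
    rw [Real.exp_add, hYind.mgf_sum hYm, Finset.mul_sum, Finset.mul_sum, ← Finset.sum_add_distrib,
      Real.exp_sum]
    gcongr with i
    · exact fun i _ => mgf_nonneg
    · exact (hkey i).2

/-- Absorbs the polynomial factor in the cubic term of the Chernoff exponent. The constant is `1 + 6
* 4³`, from `l⁵ ≤ 1 + l⁶` and the cubic term of the exponential series at `l²/4`. -/
theorem pow_five_mul_exp_neg_le (l : ℝ) (hl : 0 ≤ l) :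
    l ^ 5 * Real.exp (l ^ 2 / 4) ≤ 385 * Real.exp (l ^ 2 / 2) := by
  have h1 : (l ^ 2 / 4) ^ 3 / 6 ≤ Real.exp (l ^ 2 / 4) := by
    simpa [Nat.factorial] using Real.pow_div_factorial_le_exp (l ^ 2 / 4) (by positivity) 3
  have h2 : 1 ≤ Real.exp (l ^ 2 / 4) := Real.one_le_exp (by positivity)
  have h3 : l ^ 5 ≤ 1 + l ^ 6 := by
    rcases le_total l 1 with h | h
    · have : l ^ 5 ≤ 1 := pow_le_one₀ hl h
      have : 0 ≤ l ^ 6 := by positivity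
      linarith
    · have : l ^ 5 ≤ l ^ 6 := pow_le_pow_right₀ h (by norm_num)
      linarith
  have h4 : l ^ 5 ≤ 385 * Real.exp (l ^ 2 / 4) := by nlinarith
  calc l ^ 5 * Real.exp (l ^ 2 / 4) ≤ 385 * Real.exp (l ^ 2 / 4) * Real.exp (l ^ 2 / 4) := by
        gcongr
    _ = 385 * Real.exp (l ^ 2 / 2) := by
        rw [mul_assoc, ← Real.exp_add]; congr 2; ring

/-- One-sided moderate deviation bound at the scale `√(n log n)` for weighted sums of i.i.d.
variables with a third moment; here `r = √n` and `l = √(log n)`. -/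
theorem IsIID.moderate_deviation_upper [IsProbabilityMeasure P] {X : ℕ → Ω → ℝ}
    (hX : IsIID P X) (hX3 : MemLp (X 0) 3 P) {B : ℝ} {n : ℕ} {a : Fin n → ℝ} {r l : ℝ}
    (hr : 0 < r) (hl : 0 < l) (hrn : r ^ 2 = n) (hrl : r = Real.exp (l ^ 2 / 2))
    (ha2 : ∑ i, a i ^ 2 ≤ B * n) (ha3 : ∑ i, |a i| ^ 3 ≤ n * l ^ 2) :
    P.real {ω | (variance (X 0) P * B / 2 + 1) * (r * l) ≤
        ∑ i : Fin n, a i * (X i ω - ∫ ω, X 0 ω ∂P)} ≤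
      64 * (∫ ω, |X 0 ω - ∫ ω, X 0 ω ∂P| ^ 3 ∂P) / (r * l) +
        Real.exp (385 * ∫ ω, |X 0 ω - ∫ ω, X 0 ω ∂P| ^ 3 ∂P) / r ^ 2 := by
  set μ := ∫ ω, X 0 ω ∂P with hμ
  set κ := ∫ ω, |X 0 ω - μ| ^ 3 ∂P with hκ
  set V := variance (X 0) P with hV
  have hid : ∀ (f : ℝ → ℝ), Measurable f → ∀ i, ∫ ω, f (X i ω) ∂P = ∫ ω, f (X 0 ω) ∂P :=
    fun f hf i => (hX.identDistrib_comp hf i).integral_eq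
  have hmem : ∀ i : ℕ, MemLp (fun ω => X i ω - μ) 3 P := fun i =>
    ((hX.2.2 i).symm.memLp_snd hX3).sub (memLp_const _)
  have hXm := hX.1
  have hZmem : ∀ i : Fin n, MemLp (fun ω => a i * (X i ω - μ)) 3 P := fun i =>
    (hmem i).const_mul _
  have hκ0 : 0 ≤ κ := integral_nonneg fun ω => by positivity
  have hZ3 : ∀ i : Fin n, ∫ ω, |a i * (X i ω - μ)| ^ 3 ∂P = |a i| ^ 3 * κ := fun i => by
    simp only [abs_mul, mul_pow]
    rw [integral_const_mul, hid (fun x => |x - μ| ^ 3) (by fun_prop) i]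
  have hZ2 : ∀ i : Fin n, ∫ ω, (a i * (X i ω - μ)) ^ 2 ∂P = a i ^ 2 * V := fun i => by
    simp only [mul_pow]
    rw [integral_const_mul, hid (fun x => (x - μ) ^ 2) (by fun_prop) i, hV,
      variance_eq_integral (hXm 0).aemeasurable]
  have hbound := fuk_nagaev_third_moment (P := P) (n := n) (Z := fun i ω => a i * (X i ω - μ))
    (fun i => ((hXm i).sub_const _).const_mul _)
    ((hX.2.1.precomp Fin.val_injective).comp (fun i x => a i * (x - μ)) fun i => by fun_prop)
    (fun i => by
      simpa using (hZmem i).integrable_norm_pow (by norm_num))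
    (fun i => ((hZmem i).mono_exponent (by norm_num)).integrable_sq)
    (fun i => (hZmem i).integrable (by norm_num))
    (fun i => by
      rw [integral_const_mul, hid (fun x => x - μ) (by fun_prop) i,
        integral_sub (hX3.integrable (by norm_num)) (integrable_const _)]
      simp [hμ])
    -- The choice `t = l / r` bounds the quadratic part of the exponent by `V B l² / 2`, leaving
    -- `-l²`, that is, a factor `1/n`. The level `M = r l / 4` keeps `exp (t M) = √r`, small enough
    -- for the cubic part to stay bounded, while `M³` is large enough for a big jump to cost only
    -- `64 κ / (r l)`.
    (s := (V * B / 2 + 1) * (r * l)) (t := l / r) (M := r * l / 4) (by positivity) (by positivity)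
  refine hbound.trans ?_
  simp only [hZ3, hZ2, ← Finset.sum_mul]
  have hV0 : 0 ≤ V := variance_nonneg _ _
  have h3 : (∑ i, |a i| ^ 3) * κ ≤ r ^ 2 * l ^ 2 * κ := by
    gcongr; rwa [hrn]
  have h2 : (∑ i, a i ^ 2) * V ≤ B * r ^ 2 * V := by
    gcongr; rwa [hrn]
  refine add_le_add ?_ ?_
  · calc (∑ i, |a i| ^ 3) * κ / (r * l / 4) ^ 3 ≤ r ^ 2 * l ^ 2 * κ / (r * l / 4) ^ 3 := by gcongr
      _ = 64 * κ / (r * l) := by field_simp; ring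
  · have hinv : Real.exp (385 * κ) / r ^ 2 = Real.exp (385 * κ - l ^ 2) := by
      rw [Real.exp_sub, hrl, ← Real.exp_nat_mul]; congr 2; push_cast; ring
    rw [hinv, Real.exp_le_exp]
    have e1 : l / r * (r * l / 4) = l ^ 2 / 4 := by field_simp
    rw [e1]
    have e2 : (l / r) ^ 2 / 2 * ((∑ i, a i ^ 2) * V) ≤ V * B / 2 * l ^ 2 :=
      calc _ ≤ (l / r) ^ 2 / 2 * (B * r ^ 2 * V) := by gcongr
        _ = _ := by field_simp
    have e3 : (l / r) ^ 3 * Real.exp (l ^ 2 / 4) * ((∑ i, |a i| ^ 3) * κ) ≤ 385 * κ :=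
      calc _ ≤ (l / r) ^ 3 * Real.exp (l ^ 2 / 4) * (r ^ 2 * l ^ 2 * κ) := by gcongr
        _ = l ^ 5 * Real.exp (l ^ 2 / 4) * (κ / r) := by field_simp
        _ ≤ 385 * Real.exp (l ^ 2 / 2) * (κ / r) :=
          mul_le_mul_of_nonneg_right (pow_five_mul_exp_neg_le l hl.le) (by positivity)
        _ = 385 * κ := by rw [← hrl]; field_simp
    have e4 : -(l / r) * ((V * B / 2 + 1) * (r * l)) = -(V * B / 2 * l ^ 2) - l ^ 2 := by
      field_simp; ring
    linarith

/-- `P (S n e) = o(rate n)` uniformly in `e ∈ Q n`. -/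
def Negligible (P : Measure Ω) (rate : ℕ → ℝ) (Q : (n : ℕ) → Set (Fin n → ℝ))
    (S : (n : ℕ) → (Fin n → ℝ) → Set Ω) : Prop :=
  ∃ δ : ℕ → ℝ, Tendsto δ atTop (𝓝 0) ∧
    ∀ᶠ n in atTop, ∀ e ∈ Q n, P.real (S n e) ≤ δ n * rate n

theorem Negligible.mono [IsFiniteMeasure P] {rate : ℕ → ℝ} {Q : (n : ℕ) → Set (Fin n → ℝ)}
    {S T : (n : ℕ) → (Fin n → ℝ) → Set Ω} (hT : Negligible P rate Q T)
    (h : ∀ᶠ n in atTop, ∀ e ∈ Q n, S n e ⊆ T n e) : Negligible P rate Q S := by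
  obtain ⟨δ, hδ, hb⟩ := hT
  refine ⟨δ, hδ, ?_⟩
  filter_upwards [h, hb] with n h1 h2 e he
  exact (measureReal_mono (h1 e he)).trans (h2 e he)

theorem Negligible.iUnion {ι : Type*} [Fintype ι] [IsFiniteMeasure P] {rate : ℕ → ℝ}
    {Q : (n : ℕ) → Set (Fin n → ℝ)} {S : ι → (n : ℕ) → (Fin n → ℝ) → Set Ω}
    (h : ∀ j, Negligible P rate Q (S j)) :
    Negligible P rate Q (fun n e => ⋃ j, S j n e) := by
  choose δ hδ hb using h
  refine ⟨fun n => ∑ j, δ j n, by simpa using tendsto_finsetSum _ fun j _ => hδ j, ?_⟩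
  filter_upwards [eventually_all.2 hb] with n hn e he
  refine (measureReal_iUnion_fintype_le _).trans ?_
  rw [Finset.sum_mul]
  exact Finset.sum_le_sum fun j _ => hn j e he

theorem Negligible.union [IsFiniteMeasure P] {rate : ℕ → ℝ} {Q : (n : ℕ) → Set (Fin n → ℝ)}
    {S T : (n : ℕ) → (Fin n → ℝ) → Set Ω} (hS : Negligible P rate Q S)
    (hT : Negligible P rate Q T) : Negligible P rate Q (fun n e => S n e ∪ T n e) := by
  obtain ⟨δ, hδ, hb⟩ := hS
  obtain ⟨δ', hδ', hb'⟩ := hT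
  refine ⟨fun n => δ n + δ' n, by simpa using hδ.add hδ', ?_⟩
  filter_upwards [hb, hb'] with n h1 h2 e he
  refine (measureReal_union_le _ _).trans ?_
  rw [add_mul]
  exact add_le_add (h1 e he) (h2 e he)

/-- The weights may depend on the conditioning vector `e`, as they do when the `G` are averaged
given the errors; only a bound on their squares uniform over `Q n` matters. -/
theorem IsIID.negligible_chebyshev [IsProbabilityMeasure P] {X : ℕ → Ω → ℝ} (hX : IsIID P X)
    {f : ℝ → ℝ} (hf : Measurable f) (hf2 : MemLp (fun ω => f (X 0 ω)) 2 P)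
    {rate τ A : ℕ → ℝ} {Q : (n : ℕ) → Set (Fin n → ℝ)} (a : (n : ℕ) → (Fin n → ℝ) → Fin n → ℝ)
    (hrate : ∀ᶠ n in atTop, 0 < rate n) (hτ : ∀ᶠ n in atTop, 0 < τ n)
    (hA : ∀ᶠ n in atTop, ∀ e ∈ Q n, ∑ i, a n e i ^ 2 ≤ A n)
    (hlim : Tendsto (fun n => A n / (τ n ^ 2 * rate n)) atTop (𝓝 0)) :
    Negligible P rate Q (fun n e =>
      {ω | τ n ≤ |∑ i : Fin n, a n e i * (f (X i ω) - ∫ ω, f (X 0 ω) ∂P)|}) := by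
  refine ⟨fun n => variance (fun ω => f (X 0 ω)) P * (A n / (τ n ^ 2 * rate n)),
    by simpa using hlim.const_mul _, ?_⟩
  filter_upwards [hrate, hτ, hA] with n h1 h2 h3 e he
  refine (hX.chebyshev_weighted hf hf2 (a n e) h2).trans ?_
  rw [mul_div_assoc, mul_assoc]
  have := variance_nonneg (fun ω => f (X 0 ω)) P
  calc _ ≤ variance (fun ω => f (X 0 ω)) P * (A n / τ n ^ 2) := by gcongr; exact h3 e he
    _ = _ := by field_simp

theorem IsIID.negligible_markov [IsProbabilityMeasure P] {X : ℕ → Ω → ℝ} (hX : IsIID P X)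
    {f : ℝ → ℝ} (hf : Measurable f) (hf0 : ∀ u, 0 ≤ f u)
    (hfint : Integrable (fun ω => f (X 0 ω)) P)
    {rate τ A : ℕ → ℝ} {Q : (n : ℕ) → Set (Fin n → ℝ)} (b : (n : ℕ) → (Fin n → ℝ) → Fin n → ℝ)
    (hb : ∀ n e i, 0 ≤ b n e i)
    (hrate : ∀ᶠ n in atTop, 0 < rate n) (hτ : ∀ᶠ n in atTop, 0 < τ n)
    (hA : ∀ᶠ n in atTop, ∀ e ∈ Q n, ∑ i, b n e i ≤ A n)
    (hlim : Tendsto (fun n => A n / (τ n * rate n)) atTop (𝓝 0)) :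
    Negligible P rate Q (fun n e => {ω | τ n ≤ ∑ i : Fin n, b n e i * f (X i ω)}) := by
  refine ⟨fun n => (∫ ω, f (X 0 ω) ∂P) * (A n / (τ n * rate n)),
    by simpa using hlim.const_mul _, ?_⟩
  filter_upwards [hrate, hτ, hA] with n h1 h2 h3 e he
  refine (hX.markov_weighted hf hf0 hfint (hb n e) h2).trans ?_
  have : 0 ≤ ∫ ω, f (X 0 ω) ∂P := integral_nonneg fun ω => hf0 _
  calc _ ≤ A n * (∫ ω, f (X 0 ω) ∂P) / τ n := by gcongr; exact h3 e he
    _ = _ := by field_simp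

theorem sqrt_eq_exp_log {n : ℕ} (hn : 1 < n) :
    √(n : ℝ) = Real.exp (√(Real.log n) ^ 2 / 2) := by
  have h0 : (1 : ℝ) < n := by exact_mod_cast hn
  rw [Real.sq_sqrt (Real.log_nonneg h0.le), Real.sqrt_eq_rpow, Real.rpow_def_of_pos (by linarith)]
  congr 1; ring

theorem IsIID.negligible_moderate_deviation [IsProbabilityMeasure P] {X : ℕ → Ω → ℝ}
    (hX : IsIID P X) (hX3 : MemLp (X 0) 3 P) (B : ℝ) {Q : (n : ℕ) → Set (Fin n → ℝ)}
    (a : (n : ℕ) → (Fin n → ℝ) → Fin n → ℝ)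
    (ha2 : ∀ᶠ n : ℕ in atTop, ∀ e ∈ Q n, ∑ i, a n e i ^ 2 ≤ B * n)
    (ha3 : ∀ᶠ n : ℕ in atTop, ∀ e ∈ Q n, ∑ i, |a n e i| ^ 3 ≤ n * Real.log n) :
    Negligible P (fun n => (√(n : ℝ))⁻¹) Q (fun n e =>
      {ω | (variance (X 0) P * B / 2 + 1) * (√n * √(Real.log n)) ≤
        |∑ i : Fin n, a n e i * (X i ω - ∫ ω, X 0 ω ∂P)|}) := by
  obtain ⟨κ, hκ⟩ : ∃ κ, κ = ∫ ω, |X 0 ω - ∫ ω, X 0 ω ∂P| ^ 3 ∂P := ⟨_, rfl⟩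
  have hlog : Tendsto (fun n : ℕ => √(Real.log n)) atTop atTop :=
    Real.tendsto_sqrt_atTop.comp (Real.tendsto_log_atTop.comp tendsto_natCast_atTop_atTop)
  have hsq : Tendsto (fun n : ℕ => √(n : ℝ)) atTop atTop :=
    Real.tendsto_sqrt_atTop.comp tendsto_natCast_atTop_atTop
  -- What remains after extracting `n^{-1/2}`: the big-jump term keeps `1 / √(log n)`, the Chernoff
  -- term `1 / √n`. The factor 2 accounts for the two tails.
  refine ⟨fun n => 2 * (64 * κ / √(Real.log n) + Real.exp (385 * κ) / √n), ?_, ?_⟩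
  · simpa using ((hlog.const_div_atTop (64 * κ)).add
      (hsq.const_div_atTop (Real.exp (385 * κ)))).const_mul 2
  filter_upwards [ha2, ha3, eventually_gt_atTop 1] with n h2 h3 hn e he
  have h0 : (1 : ℝ) < n := by exact_mod_cast hn
  have hr : 0 < √(n : ℝ) := Real.sqrt_pos.2 (by linarith)
  have hl : 0 < √(Real.log n) := Real.sqrt_pos.2 (Real.log_pos h0)
  have hrn : √(n : ℝ) ^ 2 = n := Real.sq_sqrt (by linarith)
  have h3' : ∑ i, |a n e i| ^ 3 ≤ n * √(Real.log n) ^ 2 := by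
    rw [Real.sq_sqrt (Real.log_nonneg h0.le)]; exact h3 e he
  have hup := hX.moderate_deviation_upper hX3 hr hl hrn (sqrt_eq_exp_log hn) (h2 e he) h3'
  have hdown := hX.moderate_deviation_upper hX3 (a := fun i => -a n e i) hr hl hrn
    (sqrt_eq_exp_log hn) (by simpa using h2 e he) (by simpa using h3')
  rw [← hκ] at hup hdown
  set C := variance (X 0) P * B / 2 + 1
  refine (measureReal_mono (s₂ := {ω | C * (√n * √(Real.log n)) ≤
      ∑ i : Fin n, a n e i * (X i ω - ∫ ω, X 0 ω ∂P)} ∪ {ω | C * (√n * √(Real.log n)) ≤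
      ∑ i : Fin n, -a n e i * (X i ω - ∫ ω, X 0 ω ∂P)}) ?_).trans
      ((measureReal_union_le _ _).trans ((add_le_add hup hdown).trans_eq ?_))
  · intro ω hω
    rcases le_abs.1 (Set.mem_ofPred_eq ▸ hω) with h | h
    · exact Or.inl h
    · refine Or.inr ?_
      show _ ≤ ∑ i : Fin n, -a n e i * (X i ω - ∫ ω, X 0 ω ∂P)
      simpa only [neg_mul, Finset.sum_neg_distrib] using h
  · field_simp; ring

/-- Under independence the bootstrap law is the unconditional law of the perturbing quantities. -/
theorem bootstrapLaw_ae_eq [IsProbabilityMeasure P] {ε G : ℕ → Ω → ℝ} (hε : ∀ i, Measurable (ε i))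
    (hG : ∀ i, Measurable (G i))
    (hindep : IndepFun (fun ω i => G i ω) (fun ω i => ε i ω) P) (n : ℕ) :
    ∀ᵐ e ∂(P.map (firstN ε n)), bootstrapLaw P ε G n e = P.map (firstN G n) := by
  have hεm : Measurable (firstN ε n) := measurable_pi_lambda _ fun i => hε i
  have hGm : Measurable (firstN G n) := measurable_pi_lambda _ fun i => hG i
  have hι : Measurable fun (u : ℕ → ℝ) (i : Fin n) => u i := by fun_prop
  have hind : IndepFun (firstN ε n) (firstN G n) P := (hindep.comp hι hι).symm
  have : IsProbabilityMeasure (P.map (firstN G n)) :=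
    Measure.isProbabilityMeasure_map hGm.aemeasurable
  have h := condDistrib_ae_eq_of_measure_eq_compProd (μ := P) (firstN ε n) (Y := firstN G n)
    hGm.aemeasurable (κ := Kernel.const _ (P.map (firstN G n))) (by
      rw [Measure.compProd_const]
      exact (indepFun_iff_map_prod_eq_prod_map_map hεm.aemeasurable hGm.aemeasurable).1 hind)
  filter_upwards [h] with e he
  rw [bootstrapLaw, he, Kernel.const_apply]

end Probability

/-! ### Local linearity of the score and the simplified Newton iteration -/

section Score

/-- The mean value inequality is applied twice. The Hölder condition replaces `ψ''` on the interval
of radius `R` by its value at the centre `u`, which is what the moment conditions control. The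
factor `|a - b|`, rather than a quadratic error at one point, is what a contraction estimate needs.
-/
theorem score_taylor {ψ : ℝ → ℝ} {α K : ℝ} (hα : 0 ≤ α) (hK : 0 ≤ K)
    (h1 : Differentiable ℝ ψ) (h2 : Differentiable ℝ (deriv ψ))
    (h3 : ∀ u v : ℝ, |deriv (deriv ψ) u - deriv (deriv ψ) v| ≤ K * |u - v| ^ α)
    {u a b R : ℝ} (ha : |a| ≤ R) (hb : |b| ≤ R) :
    |ψ (u - a) - ψ (u - b) + deriv ψ u * (a - b)| ≤
      (|deriv (deriv ψ) u| + K * R ^ α) * R * |a - b| := by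
  have hR : 0 ≤ R := (abs_nonneg a).trans ha
  have hderiv2 : ∀ s ∈ Set.Icc (u - R) (u + R),
      ‖deriv (deriv ψ) s‖ ≤ |deriv (deriv ψ) u| + K * R ^ α := fun s hs => by
    have hsu : |s - u| ≤ R := abs_le.2 ⟨by linarith [hs.1], by linarith [hs.2]⟩
    have h4 : K * |s - u| ^ α ≤ K * R ^ α := by gcongr
    have h5 := abs_sub_abs_le_abs_sub (deriv (deriv ψ) s) (deriv (deriv ψ) u)
    rw [Real.norm_eq_abs]
    linarith [h3 s u]
  have hconst : 0 ≤ |deriv (deriv ψ) u| + K * R ^ α := by positivity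
  have hderiv1 : ∀ s ∈ Set.Icc (-R) R,
      ‖deriv ψ u - deriv ψ (u - s)‖ ≤ (|deriv (deriv ψ) u| + K * R ^ α) * R := fun s hs => by
    refine ((convex_Icc (u - R) (u + R)).norm_image_sub_le_of_norm_deriv_le
      (fun z _ => h2 z) hderiv2 ⟨by linarith [hs.2], by linarith [hs.1]⟩
      ⟨by linarith, by linarith⟩).trans ?_
    gcongr
    rw [Real.norm_eq_abs]
    exact abs_le.2 ⟨by linarith [hs.1], by linarith [hs.2]⟩
  have h := (convex_Icc (-R) R).norm_image_sub_le_of_norm_hasDerivWithin_le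
    (f := fun s => ψ (u - s) + deriv ψ u * s) (f' := fun s => deriv ψ u - deriv ψ (u - s))
    (x := b) (y := a) (fun s _ => by
      have hc := (h1 (u - s)).hasDerivAt.comp s ((hasDerivAt_id s).const_sub u)
      have hd := hc.add ((hasDerivAt_id s).const_mul (deriv ψ u))
      refine (hd.congr_deriv ?_).hasDerivWithinAt
      ring) hderiv1 (abs_le.1 hb) (abs_le.1 ha)
  rw [Real.norm_eq_abs, Real.norm_eq_abs] at h
  refine (le_of_eq ?_).trans h
  congr 1; ring

variable {p : ℕ}

theorem abs_coord_le_norm (v : Vec p) (j : Fin p) : |v j| ≤ ‖v‖ := by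
  simpa using PiLp.norm_apply_le v j

theorem norm_le_of_abs_coord_le {v : Vec p} {c : ℝ} (h : ∀ j, |v j| ≤ c) : ‖v‖ ≤ p * c := by
  have hv : v = ∑ j, v j • EuclideanSpace.single j (1 : ℝ) := by
    ext k
    simp [Finset.sum_apply, Pi.single_apply]
  rw [hv]
  refine (norm_sum_le _ _).trans ?_
  refine (Finset.sum_le_card_nsmul _ _ c fun j _ => ?_).trans_eq (by simp)
  simpa [norm_smul] using h j

theorem inner_eq_sum (u v : Vec p) : inner ℝ u v = ∑ k, u k * v k := by
  simp [PiLp.inner_apply, mul_comm]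

/-- `∑_{i < n} x_i ψ(y_i - x_i' t) w_i`. -/
def weightedScore (x : ℕ → Vec p) (ψ : ℝ → ℝ) {n : ℕ} (y w : Fin n → ℝ) (t : Vec p) : Vec p :=
  ∑ i : Fin n, (ψ (y i - inner ℝ (x i) t) * w i) • x i

theorem solvesPerturbedScore_iff {x : ℕ → Vec p} {ψ : ℝ → ℝ} {n : ℕ} {y w : Fin n → ℝ}
    {t : Vec p} : SolvesPerturbedScore x ψ y w t ↔ weightedScore x ψ y w t = 0 := Iff.rfl

theorem solvesScore_iff {x : ℕ → Vec p} {ψ : ℝ → ℝ} {n : ℕ} {y : Fin n → ℝ}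
    {t : Vec p} : SolvesScore x ψ y t ↔ weightedScore x ψ y (fun _ => 1) t = 0 := by
  simp [SolvesScore, weightedScore]

/-- Conditions under which the weighted score function with errors `e` is, near the true parameter,
close to the linear function with matrix `-n A`. -/
structure NearlyLinear (x : ℕ → Vec p) (ψ : ℝ → ℝ) (α K : ℝ) {n : ℕ} (e w : Fin n → ℝ)
    (A : Matrix (Fin p) (Fin p) ℝ) (η B : ℝ) : Prop where
  jacobian : ∀ j k, |∑ i : Fin n, w i * deriv ψ (e i) * (x i j * x i k) - n * A j k| ≤ n * η
  remainder : ∑ i : Fin n, |w i| * (‖x i‖ ^ 3 * |deriv (deriv ψ) (e i)| + K * ‖x i‖ ^ (3 + α)) ≤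
    n * B

/-- The difference splits into the Taylor remainders, of size `n ρ B`, and the discrepancy between
the Jacobian at `β` and `n A`, of size `n p² η` when estimated entrywise. -/
theorem NearlyLinear.norm_sub_le {x : ℕ → Vec p} {ψ : ℝ → ℝ} {α K : ℝ} {n : ℕ}
    {y w : Fin n → ℝ} {A : Matrix (Fin p) (Fin p) ℝ} {η B : ℝ} {β : Vec p}
    (hα : 0 ≤ α) (hK : 0 ≤ K) (h1 : Differentiable ℝ ψ) (h2 : Differentiable ℝ (deriv ψ))
    (h3 : ∀ u v : ℝ, |deriv (deriv ψ) u - deriv (deriv ψ) v| ≤ K * |u - v| ^ α)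
    (h : NearlyLinear x ψ α K (fun i => y i - inner ℝ (x i) β) w A η B)
    {ρ : ℝ} (hρ1 : ρ ≤ 1) {s t : Vec p} (hs : s ∈ Metric.closedBall β ρ)
    (ht : t ∈ Metric.closedBall β ρ) :
    ‖weightedScore x ψ y w s - weightedScore x ψ y w t
        + (n : ℝ) • Matrix.toEuclideanCLM (𝕜 := ℝ) A (s - t)‖ ≤
      n * (p ^ 2 * η + ρ * B) * ‖s - t‖ := by
  rw [mem_closedBall_iff_norm] at hs ht
  have hρ0 : 0 ≤ ρ := (norm_nonneg _).trans hs
  set e : Fin n → ℝ := fun i => y i - inner ℝ (x i) β with he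
  set r : Fin n → ℝ := fun i => ψ (e i - inner ℝ (x i) (s - β)) - ψ (e i - inner ℝ (x i) (t - β))
    + deriv ψ (e i) * (inner ℝ (x i) (s - β) - inner ℝ (x i) (t - β)) with hr
  set J : Vec p := (n : ℝ) • Matrix.toEuclideanCLM (𝕜 := ℝ) A (s - t)
    - ∑ i : Fin n, (w i * deriv ψ (e i) * inner ℝ (x i) (s - t)) • x i with hJ
  have hdecomp : weightedScore x ψ y w s - weightedScore x ψ y w t
        + (n : ℝ) • Matrix.toEuclideanCLM (𝕜 := ℝ) A (s - t)
      = ∑ i : Fin n, (r i * w i) • x i + J := by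
    have hi : ∀ i : Fin n, (ψ (y i - inner ℝ (x i) s) * w i) • x i
        - (ψ (y i - inner ℝ (x i) t) * w i) • x i =
        (r i * w i) • x i - (w i * deriv ψ (e i) * inner ℝ (x i) (s - t)) • x i := fun i => by
      rw [← sub_smul, ← sub_smul]
      congr 1
      simp only [hr, he, inner_sub_right]
      have a1 : ∀ v : Vec p, y i - inner ℝ (x i) β - (inner ℝ (x i) v - inner ℝ (x i) β)
        = y i - inner ℝ (x i) v := fun v => by ring
      rw [a1, a1]; ring
    rw [weightedScore, weightedScore, ← Finset.sum_sub_distrib, Finset.sum_congr rfl fun i _ => hi i,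
      Finset.sum_sub_distrib, hJ]
    abel
  have hr_le : ∀ i : Fin n, ‖(r i * w i) • x i‖ ≤ |w i| * (‖x i‖ ^ 3 * |deriv (deriv ψ) (e i)| +
      K * ‖x i‖ ^ (3 + α)) * (ρ * ‖s - t‖) := fun i => by
    have ha : ∀ v : Vec p, ‖v - β‖ ≤ ρ → |inner ℝ (x i) (v - β)| ≤ ‖x i‖ * ρ := fun v hv =>
      (abs_real_inner_le_norm _ _).trans (by gcongr)
    have hab : |inner ℝ (x i) (s - β) - inner ℝ (x i) (t - β)| ≤ ‖x i‖ * ‖s - t‖ := by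
      rw [← inner_sub_right, sub_sub_sub_cancel_right]
      exact abs_real_inner_le_norm _ _
    have hT := score_taylor hα hK h1 h2 h3 (u := e i) (ha s hs) (ha t ht)
    -- Since `ρ ≤ 1`, the factor `ρ ^ α` can be dropped; the remaining single factor `ρ` already
    -- makes the remainder small.
    have hpow : (‖x i‖ * ρ) ^ α ≤ ‖x i‖ ^ α := by
      refine Real.rpow_le_rpow (by positivity) ?_ hα
      exact mul_le_of_le_one_right (norm_nonneg _) hρ1
    rw [norm_smul, Real.norm_eq_abs, abs_mul]
    have h3α : ‖x i‖ ^ 3 * ‖x i‖ ^ α = ‖x i‖ ^ (3 + α) := by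
      rw [Real.rpow_add_of_nonneg (norm_nonneg _) (by norm_num) hα]; norm_cast
    calc |r i| * |w i| * ‖x i‖
        ≤ ((|deriv (deriv ψ) (e i)| + K * (‖x i‖ * ρ) ^ α) * (‖x i‖ * ρ) * (‖x i‖ * ‖s - t‖))
          * |w i| * ‖x i‖ := by
          gcongr
          exact hT.trans (by gcongr)
      _ ≤ ((|deriv (deriv ψ) (e i)| + K * ‖x i‖ ^ α) * (‖x i‖ * ρ) * (‖x i‖ * ‖s - t‖))
          * |w i| * ‖x i‖ := by gcongr
      _ = _ := by rw [← h3α]; ring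
  have hJ_le : ‖J‖ ≤ p * (p * (n * η * ‖s - t‖)) := by
    refine norm_le_of_abs_coord_le fun j => ?_
    have hJj : J j = ∑ k, -((∑ i : Fin n, w i * deriv ψ (e i) * (x i j * x i k) - n * A j k)
        * (s - t) k) := by
      rw [hJ]
      simp only [PiLp.sub_apply, PiLp.smul_apply, smul_eq_mul, WithLp.ofLp_sum, Finset.sum_apply,
        Matrix.ofLp_toEuclideanCLM, Matrix.mulVec, dotProduct,
        WithLp.ofLp_smul, Pi.smul_apply]
      simp only [inner_eq_sum, Finset.mul_sum, Finset.sum_mul, sub_mul, neg_sub,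
        Finset.sum_sub_distrib]
      rw [Finset.sum_comm]
      congr 1
      · exact Finset.sum_congr rfl fun k _ => by ring
      · refine Finset.sum_congr rfl fun k _ => Finset.sum_congr rfl fun i _ => ?_
        simp only [PiLp.sub_apply]
        ring
    rw [hJj]
    refine (Finset.abs_sum_le_sum_abs _ _).trans
      ((Finset.sum_le_card_nsmul _ _ (n * η * ‖s - t‖) fun k _ => ?_).trans_eq (by simp))
    rw [abs_neg, abs_mul]
    exact mul_le_mul (h.jacobian j k) (abs_coord_le_norm _ _) (abs_nonneg _)
      ((abs_nonneg _).trans (h.jacobian j k))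
  rw [hdecomp]
  refine (norm_add_le _ _).trans ?_
  have hsum : ‖∑ i : Fin n, (r i * w i) • x i‖ ≤ n * B * (ρ * ‖s - t‖) := by
    refine (norm_sum_le _ _).trans ((Finset.sum_le_sum fun i _ => hr_le i).trans ?_)
    rw [← Finset.sum_mul]
    gcongr
    exact h.remainder
  calc _ ≤ n * B * (ρ * ‖s - t‖) + p * (p * (n * η * ‖s - t‖)) := add_le_add hsum hJ_le
    _ = _ := by ring

/-- The simplified Newton step `t + n⁻¹ A⁻¹ ∑ x_i ψ(y_i - x_i' t) w_i`. -/
def newtonStep (x : ℕ → Vec p) (ψ : ℝ → ℝ) (A : Matrix (Fin p) (Fin p) ℝ) {n : ℕ}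
    (y w : Fin n → ℝ) (t : Vec p) : Vec p :=
  t + (n : ℝ)⁻¹ • Matrix.toEuclideanCLM (𝕜 := ℝ) A⁻¹ (weightedScore x ψ y w t)

theorem newtonStep_eq_self_iff {x : ℕ → Vec p} {ψ : ℝ → ℝ} {A : Matrix (Fin p) (Fin p) ℝ}
    (hA : IsUnit A.det) {n : ℕ} (hn : 0 < n) {y w : Fin n → ℝ} {t : Vec p} :
    newtonStep x ψ A y w t = t ↔ weightedScore x ψ y w t = 0 := by
  have hn' : (n : ℝ)⁻¹ ≠ 0 := by positivity
  have hinv : ∀ v, Matrix.toEuclideanCLM (𝕜 := ℝ) A (Matrix.toEuclideanCLM (𝕜 := ℝ) A⁻¹ v) = v :=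
    fun v => by
      rw [← mul_apply_eq_comp, ← map_mul, Matrix.mul_nonsing_inv _ hA, map_one]; rfl
  rw [newtonStep, add_eq_left, smul_eq_zero, or_iff_right hn']
  refine ⟨fun h => ?_, fun h => by rw [h, map_zero]⟩
  rw [← hinv (weightedScore x ψ y w t), h, map_zero]

/-- The linear part cancels exactly: the increment of the Newton map is `n⁻¹ A⁻¹` applied to the
deviation from linearity estimated in `NearlyLinear.norm_sub_le`. -/
theorem NearlyLinear.norm_newtonStep_sub_le {x : ℕ → Vec p} {ψ : ℝ → ℝ} {α K : ℝ} {n : ℕ}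
    (hn : 0 < n) {y w : Fin n → ℝ} {A : Matrix (Fin p) (Fin p) ℝ} (hA : IsUnit A.det)
    {η B : ℝ} {β : Vec p}
    (hα : 0 ≤ α) (hK : 0 ≤ K) (h1 : Differentiable ℝ ψ) (h2 : Differentiable ℝ (deriv ψ))
    (h3 : ∀ u v : ℝ, |deriv (deriv ψ) u - deriv (deriv ψ) v| ≤ K * |u - v| ^ α)
    (h : NearlyLinear x ψ α K (fun i => y i - inner ℝ (x i) β) w A η B)
    {ρ Λ : ℝ} (hΛ : ‖Matrix.toEuclideanCLM (𝕜 := ℝ) A⁻¹‖ ≤ Λ) (hρ1 : ρ ≤ 1)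
    (hsmall : Λ * (p ^ 2 * η + ρ * B) ≤ 1 / 2) {s t : Vec p}
    (hs : s ∈ Metric.closedBall β ρ) (ht : t ∈ Metric.closedBall β ρ) :
    ‖newtonStep x ψ A y w s - newtonStep x ψ A y w t‖ ≤ 1 / 2 * ‖s - t‖ := by
  have hn' : (0 : ℝ) < n := by exact_mod_cast hn
  have hinv : ∀ v, Matrix.toEuclideanCLM (𝕜 := ℝ) A⁻¹ (Matrix.toEuclideanCLM (𝕜 := ℝ) A v) = v :=
    fun v => by
      rw [← mul_apply_eq_comp, ← map_mul, Matrix.nonsing_inv_mul _ hA, map_one]; rfl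
  have heq : newtonStep x ψ A y w s - newtonStep x ψ A y w t = (n : ℝ)⁻¹ •
      Matrix.toEuclideanCLM (𝕜 := ℝ) A⁻¹ (weightedScore x ψ y w s - weightedScore x ψ y w t
        + (n : ℝ) • Matrix.toEuclideanCLM (𝕜 := ℝ) A (s - t)) := by
    rw [map_add, map_smul, hinv, smul_add, inv_smul_smul₀ hn'.ne', map_sub, smul_sub]
    simp only [newtonStep]
    abel
  have hΛ0 : 0 ≤ Λ := (norm_nonneg _).trans hΛ
  rw [heq, norm_smul, norm_inv, Real.norm_natCast]
  calc _ ≤ (n : ℝ)⁻¹ * (Λ * (n * (p ^ 2 * η + ρ * B) * ‖s - t‖)) := by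
        gcongr
        refine (ContinuousLinearMap.le_opNorm _ _).trans ?_
        exact mul_le_mul hΛ (h.norm_sub_le hα hK h1 h2 h3 hρ1 hs ht) (norm_nonneg _) hΛ0
    _ = Λ * (p ^ 2 * η + ρ * B) * ‖s - t‖ := by field_simp
    _ ≤ 1 / 2 * ‖s - t‖ := by gcongr

/-- Existence of a root of the weighted score near the true parameter, as the limit of simplified
Newton steps from any nearby starting point, and a bound for all roots nearby. -/
theorem NearlyLinear.exists_root {x : ℕ → Vec p} {ψ : ℝ → ℝ} {α K : ℝ} {n : ℕ}
    (hn : 0 < n) {y w : Fin n → ℝ} {A : Matrix (Fin p) (Fin p) ℝ} (hA : IsUnit A.det)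
    {η B : ℝ} {β : Vec p}
    (hα : 0 ≤ α) (hK : 0 ≤ K) (h1 : Differentiable ℝ ψ) (h2 : Differentiable ℝ (deriv ψ))
    (h3 : ∀ u v : ℝ, |deriv (deriv ψ) u - deriv (deriv ψ) v| ≤ K * |u - v| ^ α)
    (h : NearlyLinear x ψ α K (fun i => y i - inner ℝ (x i) β) w A η B)
    {ρ Λ : ℝ} (hΛ : ‖Matrix.toEuclideanCLM (𝕜 := ℝ) A⁻¹‖ ≤ Λ) (hρ0 : 0 ≤ ρ) (hρ1 : ρ ≤ 1)
    (hsmall : Λ * (p ^ 2 * η + ρ * B) ≤ 1 / 2)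
    {τ : ℝ} (hτ : ‖weightedScore x ψ y w β‖ ≤ n * τ) (hτρ : Λ * τ ≤ ρ / 2) :
    (∀ t₀ ∈ Metric.closedBall β ρ, ∃ t ∈ Metric.closedBall β ρ, weightedScore x ψ y w t = 0 ∧
      Tendsto (fun k => (newtonStep x ψ A y w)^[k] t₀) atTop (𝓝 t)) ∧
    ∀ t ∈ Metric.closedBall β ρ, weightedScore x ψ y w t = 0 → ‖t - β‖ ≤ 2 * Λ * τ := by
  have hn' : (0 : ℝ) < n := by exact_mod_cast hn
  have hΛ0 : 0 ≤ Λ := (norm_nonneg _).trans hΛ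
  set T := newtonStep x ψ A y w with hT
  have hβ : β ∈ Metric.closedBall β ρ := Metric.mem_closedBall_self hρ0
  have hcontr : ∀ s ∈ Metric.closedBall β ρ, ∀ t ∈ Metric.closedBall β ρ,
      ‖T s - T t‖ ≤ 1 / 2 * ‖s - t‖ := fun s hs t ht =>
    h.norm_newtonStep_sub_le hn hA hα hK h1 h2 h3 hΛ hρ1 hsmall hs ht
  have hTβ : ‖T β - β‖ ≤ Λ * τ := by
    rw [hT, newtonStep, add_sub_cancel_left, norm_smul, norm_inv, Real.norm_natCast]
    calc _ ≤ (n : ℝ)⁻¹ * (Λ * (n * τ)) := by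
          gcongr
          exact (ContinuousLinearMap.le_opNorm _ _).trans
            (mul_le_mul hΛ hτ (norm_nonneg _) hΛ0)
      _ = Λ * τ := by field_simp
  have hdist : ∀ t ∈ Metric.closedBall β ρ, ‖T t - β‖ ≤ 1 / 2 * ‖t - β‖ + Λ * τ := fun t ht => by
    rw [← sub_add_sub_cancel (T t) (T β) β]
    exact (norm_add_le _ _).trans (add_le_add (hcontr t ht β hβ) hTβ)
  refine ⟨fun t₀ ht₀ => ?_, fun t ht h0 => ?_⟩
  · have hmaps : Set.MapsTo T (Metric.closedBall β ρ) (Metric.closedBall β ρ) := fun t ht => by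
      have h4 := hdist t ht
      rw [mem_closedBall_iff_norm] at ht ⊢
      linarith
    have hcw : ContractingWith (1 / 2) (hmaps.restrict T _ _) := by
      refine ⟨by norm_num, LipschitzWith.of_dist_le_mul fun s t => ?_⟩
      rw [Subtype.dist_eq, Subtype.dist_eq, dist_eq_norm, dist_eq_norm]
      simpa using hcontr s s.2 t t.2
    obtain ⟨t, ht, hfix, hlim, -⟩ := hcw.exists_fixedPoint'
      Metric.isClosed_closedBall.isComplete hmaps ht₀ (edist_ne_top _ _)
    exact ⟨t, ht, (newtonStep_eq_self_iff hA hn).1 hfix, hlim⟩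
  · have h4 := hdist t ht
    rw [show T t = t from (newtonStep_eq_self_iff hA hn).2 h0] at h4
    linarith

/-- The limit of the simplified Newton steps from the starting point `t₀`. -/
def newtonLimit (x : ℕ → Vec p) (ψ : ℝ → ℝ) (A : Matrix (Fin p) (Fin p) ℝ) {n : ℕ}
    (t₀ : (Fin n → ℝ) → Vec p) (y w : Fin n → ℝ) : Vec p :=
  limUnder atTop fun k => (newtonStep x ψ A y w)^[k] (t₀ y)

theorem measurable_weightedScore {x : ℕ → Vec p} {ψ : ℝ → ℝ} (hψ : Measurable ψ) {n : ℕ}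
    {E : Type*} [MeasurableSpace E] {y w : E → Fin n → ℝ} {t : E → Vec p} (hy : Measurable y)
    (hw : Measurable w) (ht : Measurable t) :
    Measurable fun u => weightedScore x ψ (y u) (w u) (t u) := by
  unfold weightedScore
  refine Finset.measurable_sum _ fun i _ => Measurable.smul_const (Measurable.mul ?_ ?_) _
  · exact hψ.comp (((measurable_pi_apply i).comp hy).sub (ht.const_inner))
  · exact (measurable_pi_apply i).comp hw

/-- Each iterate is jointly measurable in responses and weights. `limUnder` remains measurable even
where the iterates diverge and its value is arbitrary. -/
theorem measurable_newtonLimit {x : ℕ → Vec p} {ψ : ℝ → ℝ} (hψ : Measurable ψ)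
    (A : Matrix (Fin p) (Fin p) ℝ) {n : ℕ} {t₀ : (Fin n → ℝ) → Vec p} (ht₀ : Measurable t₀) :
    Measurable (Function.uncurry (newtonLimit x ψ A t₀)) := by
  have hiter : ∀ k, Measurable fun q : (Fin n → ℝ) × (Fin n → ℝ) =>
      (newtonStep x ψ A q.1 q.2)^[k] (t₀ q.1) := fun k => by
    induction k with
    | zero => exact ht₀.comp measurable_fst
    | succ k ih =>
      simp only [Function.iterate_succ_apply']
      have hlin : Measurable fun v : Vec p =>
          (n : ℝ)⁻¹ • Matrix.toEuclideanCLM (𝕜 := ℝ) A⁻¹ v := by fun_prop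
      exact ih.add (hlin.comp (measurable_weightedScore hψ measurable_fst measurable_snd ih))
  exact (StronglyMeasurable.limUnder fun k => (hiter k).stronglyMeasurable).measurable

end Score

/-! ### Power sums of the design vectors -/

section Design

variable {p : ℕ} {x : ℕ → Vec p}

theorem gram_apply (x : ℕ → Vec p) (n : ℕ) (j k : Fin p) :
    gram x n j k = ∑ i : Fin n, x i j * x i k := by
  rw [gram, Matrix.sum_apply, Finset.sum_range]
  rfl

theorem eventually_abs_gram_sub_le {A₁ : Matrix (Fin p) (Fin p) ℝ}
    (hA : Tendsto (designAverage x) atTop (𝓝 A₁)) {η : ℝ} (hη : 0 < η) :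
    ∀ᶠ n : ℕ in atTop, ∀ j k, |gram x n j k - n * A₁ j k| ≤ n * η := by
  have h : ∀ j k, ∀ᶠ n : ℕ in atTop, |designAverage x n j k - A₁ j k| < η := fun j k => by
    have hjk : Tendsto (fun n => designAverage x n j k) atTop (𝓝 (A₁ j k)) :=
      (continuous_id.matrix_elem j k).continuousAt.tendsto.comp hA
    simpa [Real.dist_eq] using Metric.tendsto_nhds.1 hjk η hη
  filter_upwards [eventually_all.2 fun j => eventually_all.2 (h j), eventually_gt_atTop 0]
    with n hn hn0 j k
  have hn' : (0 : ℝ) < n := by exact_mod_cast hn0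
  have heq : gram x n j k - n * A₁ j k = n * (designAverage x n j k - A₁ j k) := by
    rw [designAverage, Matrix.smul_apply, smul_eq_mul]; field_simp
  rw [heq, abs_mul, Nat.abs_cast]
  gcongr
  exact (hn j k).le

section
open scoped MatrixOrder

theorem posSemidef_gram (x : ℕ → Vec p) (n : ℕ) : (gram x n).PosSemidef := by
  refine Matrix.posSemidef_sum _ fun i _ => ?_
  simpa using Matrix.posSemidef_vecMulVec_self_star (x i).ofLp

theorem rootGram_mul_self (x : ℕ → Vec p) (n : ℕ) : rootGram x n * rootGram x n = gram x n :=
  CFC.sqrt_mul_sqrt_self _ (Matrix.nonneg_iff_posSemidef.2 (posSemidef_gram x n))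

theorem rootGram_transpose (x : ℕ → Vec p) (n : ℕ) : (rootGram x n).transpose = rootGram x n := by
  have h : (rootGram x n).IsHermitian :=
    (Matrix.nonneg_iff_posSemidef.1 (CFC.sqrt_nonneg (gram x n))).1
  simpa [Matrix.IsHermitian, Matrix.conjTranspose_eq_transpose_of_trivial] using h

end

/-- The root is symmetric, so a diagonal entry of `gram x n` is the squared norm of the
corresponding row of the root. -/
theorem abs_rootGram_apply_le (x : ℕ → Vec p) (n : ℕ) (j k : Fin p) :
    |rootGram x n j k| ≤ √(gram x n j j) := by
  refine Real.abs_le_sqrt ?_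
  rw [← rootGram_mul_self, Matrix.mul_apply]
  have h : ∀ l, rootGram x n l j = rootGram x n j l := fun l =>
    congrFun (congrFun (rootGram_transpose x n) j) l
  simp only [h, ← sq]
  exact Finset.single_le_sum (f := fun l => rootGram x n j l ^ 2) (fun l _ => sq_nonneg _)
    (Finset.mem_univ k)

/-- Undoes the standardization: `x i = D_n d_i` when `D_n` is invertible, and the entries of `D_n`
are at most of order `√n`. -/
theorem norm_le_mul_norm_dVec {n : ℕ} (hdet : (gram x n).det ≠ 0) {c : ℝ}
    (hc : ∀ j, gram x n j j ≤ n * c) (i : ℕ) :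
    ‖x i‖ ≤ p ^ 2 * √(n * c) * ‖dVec x n i‖ := by
  have hroot : IsUnit (rootGram x n).det := by
    rw [isUnit_iff_ne_zero]
    intro h0
    rw [← rootGram_mul_self, Matrix.det_mul, h0, mul_zero] at hdet
    exact hdet rfl
  have hxi : ∀ j, x i j = ∑ k, rootGram x n j k * dVec x n i k := fun j => by
    have h : (rootGram x n).mulVec ((rootGram x n)⁻¹.mulVec (x i).ofLp) = (x i).ofLp := by
      rw [Matrix.mulVec_mulVec, Matrix.mul_nonsing_inv _ hroot, Matrix.one_mulVec]
    exact (congrFun h j).symm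
  have hj : ∀ j, |x i j| ≤ p * (√(n * c) * ‖dVec x n i‖) := fun j => by
    rw [hxi]
    refine (Finset.abs_sum_le_sum_abs _ _).trans
      ((Finset.sum_le_card_nsmul _ _ (√(n * c) * ‖dVec x n i‖) fun k _ => ?_).trans_eq (by simp))
    rw [abs_mul]
    exact mul_le_mul ((abs_rootGram_apply_le x n j k).trans (Real.sqrt_le_sqrt (hc j)))
      (abs_coord_le_norm _ _) (abs_nonneg _) (Real.sqrt_nonneg _)
  refine (norm_le_of_abs_coord_le hj).trans_eq (by ring)

/-- Squaring the growth condition gives `∑ ‖d_i‖^{6+2α} ≤ C² n^{-(2+α)}`. Returning to `x_i` costs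
`n^{3+α}`, which leaves order `n`. Lower powers follow from `t^q ≤ 1 + t^{6+2α}`. -/
theorem DesignConditions.sum_norm_rpow_le {Ω : Type*} [MeasurableSpace Ω] {P : Measure Ω}
    {ψ : ℝ → ℝ} {ε : ℕ → Ω → ℝ} {α : ℝ} (hα : 0 ≤ α) (hx : DesignConditions P x ψ ε α) :
    ∃ B : ℝ, 0 ≤ B ∧ ∀ᶠ n : ℕ in atTop, ∀ q : ℝ, 0 ≤ q → q ≤ 6 + 2 * α →
      ∑ i : Fin n, ‖x i‖ ^ q ≤ B * n := by
  obtain ⟨A₁, hpos, hA⟩ := hx.average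
  obtain ⟨L, J, -, hO⟩ := hx.growth
  obtain ⟨C, hC⟩ := hO.bound
  obtain ⟨c, hc0, hc⟩ : ∃ c : ℝ, 0 ≤ c ∧ ∀ j, A₁ j j + 1 ≤ c :=
    ⟨∑ j, |A₁ j j + 1|, by positivity, fun j => (le_abs_self _).trans
      (Finset.single_le_sum (f := fun j => |A₁ j j + 1|) (fun j _ => abs_nonneg _)
        (Finset.mem_univ j))⟩
  have hdet : ∀ᶠ n in atTop, (designAverage x n).det ≠ 0 :=
    ((Continuous.matrix_det continuous_id).continuousAt.tendsto.comp hA).eventually_ne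
      hpos.det_pos.ne'
  set q₀ : ℝ := 6 + 2 * α with hq₀
  set M : ℝ := p ^ 2 * √c with hM
  have hM0 : 0 ≤ M := by positivity
  refine ⟨1 + M ^ q₀ * C ^ 2, by positivity, ?_⟩
  filter_upwards [hC, hdet, eventually_abs_gram_sub_le hA one_pos, eventually_gt_atTop 0]
    with n hCn hdetn hgram hn0 q hq0 hq
  have hn : (0 : ℝ) < n := by exact_mod_cast hn0
  have hgd : (gram x n).det ≠ 0 := fun h0 => hdetn (by simp [designAverage, h0])
  have hgjj : ∀ j, gram x n j j ≤ n * c := fun j => by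
    have h1 := (abs_le.1 (hgram j j)).2
    have h2 : (n : ℝ) * (A₁ j j + 1) ≤ n * c := by gcongr; exact hc j
    linarith
  set S : ℝ := ∑ i ∈ Finset.range n, ‖dVec x n i‖ ^ q₀ with hS
  have hS0 : 0 ≤ S := Finset.sum_nonneg fun i _ => by positivity
  have hSle : S ≤ C ^ 2 * (n : ℝ) ^ (-(2 + α)) := by
    rw [Real.norm_of_nonneg (by positivity), Real.norm_of_nonneg (by positivity)] at hCn
    have h1 : (n : ℝ) ^ (α / 2) * S ^ (1 / 2 : ℝ) ≤ C * (n : ℝ)⁻¹ :=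
      le_trans (le_add_of_nonneg_right (Finset.sum_nonneg fun i _ => by positivity)) hCn
    have h2 : ((n : ℝ) ^ (α / 2) * S ^ (1 / 2 : ℝ)) ^ 2 ≤ (C * (n : ℝ)⁻¹) ^ 2 := by gcongr
    have h3 : ((n : ℝ) ^ (α / 2) * S ^ (1 / 2 : ℝ)) ^ 2 = (n : ℝ) ^ α * S := by
      rw [mul_pow, ← Real.rpow_natCast, ← Real.rpow_mul hn.le, ← Real.rpow_natCast (S ^ _),
        ← Real.rpow_mul hS0]
      norm_num
    rw [h3, mul_pow] at h2
    rw [Real.rpow_neg hn.le, Real.rpow_add hn, Real.rpow_two, ← div_eq_mul_inv,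
      le_div_iff₀ (by positivity)]
    calc S * ((n : ℝ) ^ 2 * (n : ℝ) ^ α) = (n : ℝ) ^ α * S * (n : ℝ) ^ 2 := by ring
      _ ≤ C ^ 2 * (n : ℝ)⁻¹ ^ 2 * (n : ℝ) ^ 2 := by gcongr
      _ = C ^ 2 := by field_simp
  have hterm : ∀ i : ℕ, ‖x i‖ ^ q₀ ≤ M ^ q₀ * (n : ℝ) ^ (3 + α) * ‖dVec x n i‖ ^ q₀ := fun i => by
    have h1 : ‖x i‖ ≤ M * √n * ‖dVec x n i‖ := by
      refine (norm_le_mul_norm_dVec hgd hgjj i).trans_eq ?_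
      rw [Real.sqrt_mul hn.le, hM]; ring
    refine (Real.rpow_le_rpow (norm_nonneg _) h1 (by positivity)).trans_eq ?_
    rw [Real.mul_rpow (by positivity) (norm_nonneg _), Real.mul_rpow hM0 (Real.sqrt_nonneg _),
      Real.sqrt_eq_rpow, ← Real.rpow_mul hn.le]
    congr 3
    rw [hq₀]; ring
  have htop : ∑ i : Fin n, ‖x i‖ ^ q₀ ≤ M ^ q₀ * C ^ 2 * n := by
    rw [← Finset.sum_range (f := fun i => ‖x i‖ ^ q₀)]
    refine (Finset.sum_le_sum fun i _ => hterm i).trans ?_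
    rw [← Finset.mul_sum]
    calc M ^ q₀ * (n : ℝ) ^ (3 + α) * S
        ≤ M ^ q₀ * (n : ℝ) ^ (3 + α) * (C ^ 2 * (n : ℝ) ^ (-(2 + α))) := by gcongr
      _ = M ^ q₀ * C ^ 2 * ((n : ℝ) ^ (3 + α) * (n : ℝ) ^ (-(2 + α))) := by ring
      _ = M ^ q₀ * C ^ 2 * n := by
        rw [← Real.rpow_add hn, show 3 + α + -(2 + α) = 1 by ring, Real.rpow_one]
  have hqi : ∀ i : Fin n, ‖x i‖ ^ q ≤ 1 + ‖x i‖ ^ q₀ := fun i => by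
    rcases le_total ‖x i‖ 1 with h | h
    · exact (Real.rpow_le_one (norm_nonneg _) h hq0).trans
        (le_add_of_nonneg_right (by positivity))
    · exact (Real.rpow_le_rpow_of_exponent_le h hq).trans (le_add_of_nonneg_left zero_le_one)
  calc ∑ i : Fin n, ‖x i‖ ^ q ≤ ∑ i : Fin n, (1 + ‖x i‖ ^ q₀) := Finset.sum_le_sum fun i _ => hqi i
    _ = n + ∑ i : Fin n, ‖x i‖ ^ q₀ := by rw [Finset.sum_add_distrib]; simp
    _ ≤ n + M ^ q₀ * C ^ 2 * n := by gcongr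
    _ = _ := by ring

end Design

/-! ### Limits comparing thresholds and rates -/

section Limits

theorem tendsto_const_mul_div_mul_log (B : ℝ) :
    Tendsto (fun n : ℕ => B * n / (n * Real.log n)) atTop (𝓝 0) := by
  have h : Tendsto (fun n : ℕ => Real.log n) atTop atTop :=
    Real.tendsto_log_atTop.comp tendsto_natCast_atTop_atTop
  refine (h.const_div_atTop B).congr' ?_
  filter_upwards [eventually_gt_atTop 0] with n hn
  have : (0 : ℝ) < n := by exact_mod_cast hn
  field_simp

theorem tendsto_const_mul_div_sq (B η : ℝ) :
    Tendsto (fun n : ℕ => B * n / (n * η) ^ 2) atTop (𝓝 0) := by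
  have h : Tendsto (fun n : ℕ => (n : ℝ)) atTop atTop := tendsto_natCast_atTop_atTop
  refine (h.const_div_atTop (B / η ^ 2)).congr' ?_
  filter_upwards [eventually_gt_atTop 0] with n hn
  have : (0 : ℝ) < n := by exact_mod_cast hn
  field_simp

theorem tendsto_log_div_sqrt : Tendsto (fun n : ℕ => Real.log n / √(n : ℝ)) atTop (𝓝 0) := by
  have h := (isLittleO_log_rpow_atTop (r := 1 / 2) (by norm_num)).tendsto_div_nhds_zero.comp
    tendsto_natCast_atTop_atTop
  refine h.congr fun n => ?_
  simp [Real.sqrt_eq_rpow]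

/-- Shows that Chebyshev at threshold `n η`, with squared weights summing to order `n log n`, beats
the rate `n^{-1/2}`: the quotient is of order `log n / √n`. -/
theorem tendsto_mul_log_add_div_sq (B B' η : ℝ) :
    Tendsto (fun n : ℕ => (B * (n * Real.log n) + B' * n) / ((n * η) ^ 2 * (√(n : ℝ))⁻¹))
      atTop (𝓝 0) := by
  have hsq : Tendsto (fun n : ℕ => √(n : ℝ)) atTop atTop :=
    Real.tendsto_sqrt_atTop.comp tendsto_natCast_atTop_atTop
  have h := (tendsto_log_div_sqrt.const_mul (B / η ^ 2)).add (hsq.const_div_atTop (B' / η ^ 2))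
  rw [mul_zero, add_zero] at h
  refine h.congr' ?_
  filter_upwards [eventually_gt_atTop 0] with n hn
  have hn' : (0 : ℝ) < n := by exact_mod_cast hn
  have hr : 0 < √(n : ℝ) := Real.sqrt_pos.2 hn'
  rcases eq_or_ne η 0 with rfl | hη
  · simp
  have hrn : (n : ℝ) = √(n : ℝ) ^ 2 := (Real.sq_sqrt hn'.le).symm
  generalize Real.log n = l
  generalize √(n : ℝ) = r at *
  rw [hrn]
  field_simp

theorem tendsto_sqrt_mul_sqrt_log_div (C : ℝ) :
    Tendsto (fun n : ℕ => C * (√(n : ℝ) * √(Real.log n)) / n) atTop (𝓝 0) := by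
  have h := (tendsto_log_div_sqrt).mul
    ((Real.tendsto_sqrt_atTop.comp (Real.tendsto_log_atTop.comp
      tendsto_natCast_atTop_atTop)).const_div_atTop C)
  rw [zero_mul] at h
  refine h.congr' ?_
  filter_upwards [eventually_gt_atTop 1] with n hn
  have hn' : (1 : ℝ) < n := by exact_mod_cast hn
  have hl : 0 < √(Real.log n) := Real.sqrt_pos.2 (Real.log_pos hn')
  have hr : 0 < √(n : ℝ) := Real.sqrt_pos.2 (by linarith)
  have hln : Real.log n = √(Real.log n) ^ 2 := (Real.sq_sqrt (Real.log_nonneg hn'.le)).symm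
  have hrn : (n : ℝ) = √(n : ℝ) ^ 2 := (Real.sq_sqrt (by linarith)).symm
  simp only [Function.comp_apply]
  rw [div_mul_div_comm, div_eq_div_iff (by positivity) (by positivity)]
  calc Real.log n * C * n = √(Real.log n) ^ 2 * C * √(n : ℝ) ^ 2 := by rw [← hln, ← hrn]
    _ = _ := by ring

end Limits

/-! ### Typical errors, and the perturbed score given typical errors -/

section Errors

variable {Ω : Type*} [MeasurableSpace Ω] {P : Measure Ω} {p : ℕ} {x : ℕ → Vec p}

theorem integrable_abs_pow_of_le [IsFiniteMeasure P] {f : Ω → ℝ} (hf : Measurable f) {j k : ℕ}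
    (hjk : j ≤ k) (h : Integrable (fun ω => |f ω| ^ k) P) : Integrable (fun ω => |f ω| ^ j) P := by
  refine ((integrable_const (1 : ℝ)).add h).mono' (by fun_prop) (ae_of_all _ fun ω => ?_)
  rw [Real.norm_of_nonneg (by positivity)]
  show |f ω| ^ j ≤ 1 + |f ω| ^ k
  rcases le_total |f ω| 1 with h1 | h1
  · exact (pow_le_one₀ (abs_nonneg _) h1).trans (le_add_of_nonneg_right (by positivity))
  · exact (pow_le_pow_right₀ h1 hjk).trans (le_add_of_nonneg_left zero_le_one)

/-- The errors are typical: the score function is nearly linear, and the sums that govern the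
conditional moments of the perturbed score are of the expected order. -/
structure TypicalErrors (x : ℕ → Vec p) (ψ : ℝ → ℝ) (α K : ℝ) (A : Matrix (Fin p) (Fin p) ℝ)
    (η B : ℝ) {n : ℕ} (e : Fin n → ℝ) : Prop where
  nearlyLinear : NearlyLinear x ψ α K e (fun _ => 1) A η B
  score : ∀ j, |∑ i : Fin n, x i j * ψ (e i)| ≤ √n * √(Real.log n)
  score_sq : ∑ i : Fin n, ‖x i‖ ^ 2 * ψ (e i) ^ 2 ≤ B * n
  score_cube : ∑ i : Fin n, ‖x i‖ ^ 3 * |ψ (e i)| ^ 3 ≤ n * Real.log n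
  deriv_sq : ∑ i : Fin n, ‖x i‖ ^ 4 * deriv ψ (e i) ^ 2 ≤ n * Real.log n
  deriv2_sq : ∑ i : Fin n, ‖x i‖ ^ 6 * deriv (deriv ψ) (e i) ^ 2 ≤ n * Real.log n

theorem measurableSet_typicalErrors {ψ : ℝ → ℝ} (h1 : Measurable ψ) (α K : ℝ)
    (A : Matrix (Fin p) (Fin p) ℝ) (η B : ℝ) (n : ℕ) :
    MeasurableSet {e : Fin n → ℝ | TypicalErrors x ψ α K A η B e} := by
  have h2 : Measurable (deriv ψ) := measurable_deriv ψ
  have h3 : Measurable (deriv (deriv ψ)) := measurable_deriv _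
  have heq : {e : Fin n → ℝ | TypicalErrors x ψ α K A η B e} =
      {e | ∀ j k, |∑ i : Fin n, 1 * deriv ψ (e i) * (x i j * x i k) - n * A j k| ≤ n * η} ∩
      {e | ∑ i : Fin n, |(1 : ℝ)| * (‖x i‖ ^ 3 * |deriv (deriv ψ) (e i)| +
        K * ‖x i‖ ^ (3 + α)) ≤ n * B} ∩
      {e | ∀ j, |∑ i : Fin n, x i j * ψ (e i)| ≤ √n * √(Real.log n)} ∩
      {e | ∑ i : Fin n, ‖x i‖ ^ 2 * ψ (e i) ^ 2 ≤ B * n} ∩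
      {e | ∑ i : Fin n, ‖x i‖ ^ 3 * |ψ (e i)| ^ 3 ≤ n * Real.log n} ∩
      {e | ∑ i : Fin n, ‖x i‖ ^ 4 * deriv ψ (e i) ^ 2 ≤ n * Real.log n} ∩
      {e | ∑ i : Fin n, ‖x i‖ ^ 6 * deriv (deriv ψ) (e i) ^ 2 ≤ n * Real.log n} := by
    ext e
    exact ⟨fun h => ⟨⟨⟨⟨⟨⟨h.1.1, h.1.2⟩, h.2⟩, h.3⟩, h.4⟩, h.5⟩, h.6⟩,
      fun ⟨⟨⟨⟨⟨⟨a, b⟩, c⟩, d⟩, e⟩, f⟩, g⟩ => ⟨⟨a, b⟩, c, d, e, f, g⟩⟩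
  rw [heq]
  refine (((((MeasurableSet.inter ?_ ?_).inter ?_).inter ?_).inter ?_).inter ?_).inter ?_
  · simp only [Set.ofPred_forall]
    exact MeasurableSet.iInter fun j => MeasurableSet.iInter fun k =>
      measurableSet_le (by fun_prop) measurable_const
  · exact measurableSet_le (by fun_prop) measurable_const
  · simp only [Set.ofPred_forall]
    exact MeasurableSet.iInter fun j => measurableSet_le (by fun_prop) measurable_const
  all_goals exact measurableSet_le (by fun_prop) measurable_const

theorem abs_coord_mul_coord_le (v : Vec p) (j k : Fin p) : (v j * v k) ^ 2 ≤ ‖v‖ ^ 4 := by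
  have h : |v j * v k| ≤ ‖v‖ ^ 2 := by
    rw [abs_mul, sq]
    exact mul_le_mul (abs_coord_le_norm v j) (abs_coord_le_norm v k) (abs_nonneg _) (norm_nonneg _)
  calc (v j * v k) ^ 2 = |v j * v k| ^ 2 := (sq_abs _).symm
    _ ≤ (‖v‖ ^ 2) ^ 2 := by gcongr
    _ = ‖v‖ ^ 4 := by ring

/-- A bound `∑_{i < n} ‖x_i‖^q ≤ B n` for all exponents up to `6 + 2 α` and all large `n`. -/
def PowerSumBound (x : ℕ → Vec p) (α B : ℝ) : Prop :=
  ∀ᶠ n : ℕ in atTop, ∀ q : ℝ, 0 ≤ q → q ≤ 6 + 2 * α → ∑ i : Fin n, ‖x i‖ ^ q ≤ B * n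

theorem PowerSumBound.eventually_pow {α B : ℝ} (hα : 0 ≤ α) (h : PowerSumBound x α B) {k : ℕ}
    (hk : k ≤ 6) : ∀ᶠ n : ℕ in atTop, ∑ i : Fin n, ‖x i‖ ^ k ≤ B * n := by
  filter_upwards [h] with n hn
  have hk' : (k : ℝ) ≤ 6 := by exact_mod_cast hk
  simpa using hn k (by positivity) (by linarith)

/-- `B` is fixed before `η`, because the tolerances are later chosen in terms of `B`. The sum
`score_sq` must be `O(n)`, as it enters a Gaussian exponent, and this uses the fourth moment of `ψ`;
for the cubic and derivative sums Markov with a spare `log n` is enough. -/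
theorem negligible_not_typicalErrors [IsProbabilityMeasure P] {ψ : ℝ → ℝ} {ε : ℕ → Ω → ℝ}
    {α K Bx : ℝ} (hε : IsIID P ε) (hα : 0 ≤ α) (hK : 0 ≤ K) (hBx : 0 ≤ Bx)
    (h1 : Measurable ψ)
    (hmom : ErrorMoments P ψ (ε 0)) (hsum : PowerSumBound x α Bx) {A₁ : Matrix (Fin p) (Fin p) ℝ}
    (hA : Tendsto (designAverage x) atTop (𝓝 A₁)) :
    ∃ B : ℝ, 0 ≤ B ∧ ∀ η : ℝ, 0 < η → Negligible P (fun _ => 1) (fun _ => Set.univ) (fun n _ =>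
      {ω | ¬ TypicalErrors x ψ α K ((∫ ω, deriv ψ (ε 0 ω) ∂P) • A₁) η B (firstN ε n ω)}) := by
  have h2 : Measurable (deriv ψ) := measurable_deriv ψ
  have h3 : Measurable (deriv (deriv ψ)) := measurable_deriv _
  have hε0 : Measurable (ε 0) := hε.1 0
  set c := ∫ ω, deriv ψ (ε 0 ω) ∂P with hc
  set m₂ := ∫ ω, ψ (ε 0 ω) ^ 2 ∂P with hm₂
  set d₂ := ∫ ω, |deriv (deriv ψ) (ε 0 ω)| ∂P with hd₂
  have hm₂0 : 0 ≤ m₂ := integral_nonneg fun ω => sq_nonneg _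
  have hd₂0 : 0 ≤ d₂ := integral_nonneg fun ω => abs_nonneg _
  have hrate : ∀ᶠ n : ℕ in atTop, (0 : ℝ) < 1 := Eventually.of_forall fun _ => one_pos
  have hnpos : ∀ᶠ n : ℕ in atTop, (0 : ℝ) < n :=
    (eventually_gt_atTop 0).mono fun n hn => by exact_mod_cast hn
  have hlogpos : ∀ᶠ n : ℕ in atTop, (0 : ℝ) < Real.log n :=
    (eventually_gt_atTop 1).mono fun n hn => Real.log_pos (by exact_mod_cast hn)
  have hp : ∀ {k : ℕ}, k ≤ 6 → ∀ᶠ n : ℕ in atTop, ∑ i : Fin n, ‖x i‖ ^ k ≤ Bx * n :=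
    fun hk => hsum.eventually_pow hα hk
  have hψ2 : MemLp (fun ω => ψ (ε 0 ω)) 2 P :=
    (memLp_two_iff_integrable_sq (Measurable.aestronglyMeasurable (by fun_prop))).2 (by
      simpa using integrable_abs_pow_of_le (h1.comp hε0) (j := 2) (by norm_num) hmom.moment_score)
  have hψsq2 : MemLp (fun ω => ψ (ε 0 ω) ^ 2) 2 P :=
    (memLp_two_iff_integrable_sq (Measurable.aestronglyMeasurable (by fun_prop))).2 (by
      refine hmom.moment_score.congr (ae_of_all _ fun ω => ?_)
      show |ψ (ε 0 ω)| ^ 4 = (ψ (ε 0 ω) ^ 2) ^ 2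
      rw [← sq_abs (ψ _)]; ring)
  have hd1int : Integrable (fun ω => deriv ψ (ε 0 ω) ^ 2) P := by
    simpa using integrable_abs_pow_of_le (h2.comp hε0) (j := 2) (by norm_num) hmom.moment_deriv
  have hd2 : MemLp (fun ω => deriv ψ (ε 0 ω)) 2 P :=
    (memLp_two_iff_integrable_sq (Measurable.aestronglyMeasurable (by fun_prop))).2 hd1int
  have hdd2 : MemLp (fun ω => |deriv (deriv ψ) (ε 0 ω)|) 2 P :=
    (memLp_two_iff_integrable_sq (Measurable.aestronglyMeasurable (by fun_prop))).2 hmom.moment_deriv2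
  have hscore : ∀ j, Negligible P (fun _ => 1) (fun _ => Set.univ) (fun n _ =>
      {ω | √n * √(Real.log n) ≤
        |∑ i : Fin n, x i j * (ψ (ε i ω) - ∫ ω, ψ (ε 0 ω) ∂P)|}) := fun j => by
    refine hε.negligible_chebyshev h1 hψ2 (τ := fun n => √n * √(Real.log n))
      (A := fun n => Bx * n) (fun n _ i => x i j) hrate ?_ ?_ ?_
    · filter_upwards [hnpos, hlogpos] with n h4 h5
      exact mul_pos (Real.sqrt_pos.2 h4) (Real.sqrt_pos.2 h5)
    · filter_upwards [hp (k := 2) (by norm_num)] with n hn e _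
      refine (Finset.sum_le_sum fun i _ => ?_).trans hn
      rw [← sq_abs]
      gcongr
      exact abs_coord_le_norm _ _
    · refine (tendsto_const_mul_div_mul_log Bx).congr' ?_
      filter_upwards [hnpos, hlogpos] with n h4 h5
      rw [mul_pow, Real.sq_sqrt h4.le, Real.sq_sqrt h5.le, mul_one]
  have hjac : ∀ η : ℝ, 0 < η → ∀ j k, Negligible P (fun _ => 1) (fun _ => Set.univ) (fun n _ =>
      {ω | n * (η / 2) ≤ |∑ i : Fin n, x i j * x i k * (deriv ψ (ε i ω) - c)|}) :=
    fun η hη j k => by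
    refine hε.negligible_chebyshev h2 hd2 (τ := fun n => n * (η / 2))
      (A := fun n => Bx * n) (fun n _ i => x i j * x i k) hrate ?_ ?_ ?_
    · filter_upwards [hnpos] with n h4
      positivity
    · filter_upwards [hp (k := 4) (by norm_num)] with n hn e _
      exact (Finset.sum_le_sum fun i _ => abs_coord_mul_coord_le _ _ _).trans hn
    · simpa using tendsto_const_mul_div_sq Bx (η / 2)
  have hrem : Negligible P (fun _ => 1) (fun _ => Set.univ) (fun n _ =>
      {ω | n ≤ |∑ i : Fin n, ‖x i‖ ^ 3 * (|deriv (deriv ψ) (ε i ω)| - d₂)|}) := by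
    refine hε.negligible_chebyshev (f := fun u => |deriv (deriv ψ) u|) (by fun_prop) hdd2
      (τ := fun n => n) (A := fun n => Bx * n) (fun n _ i => ‖x i‖ ^ 3) hrate hnpos ?_ ?_
    · filter_upwards [hp (k := 6) (by norm_num)] with n hn e _
      simpa [← pow_mul] using hn
    · simpa using tendsto_const_mul_div_sq Bx 1
  have hsq : Negligible P (fun _ => 1) (fun _ => Set.univ) (fun n _ =>
      {ω | n ≤ |∑ i : Fin n, ‖x i‖ ^ 2 * (ψ (ε i ω) ^ 2 - m₂)|}) := by
    refine hε.negligible_chebyshev (f := fun u => ψ u ^ 2) (by fun_prop) hψsq2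
      (τ := fun n => n) (A := fun n => Bx * n) (fun n _ i => ‖x i‖ ^ 2) hrate hnpos ?_ ?_
    · filter_upwards [hp (k := 4) (by norm_num)] with n hn e _
      simpa [← pow_mul] using hn
    · simpa using tendsto_const_mul_div_sq Bx 1
  have hmarkov : ∀ (f : ℝ → ℝ), Measurable f → (∀ u, 0 ≤ f u) →
      Integrable (fun ω => f (ε 0 ω)) P → ∀ k ≤ 6, Negligible P (fun _ => 1) (fun _ => Set.univ)
        (fun n _ => {ω | n * Real.log n ≤ ∑ i : Fin n, ‖x i‖ ^ k * f (ε i ω)}) :=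
    fun f hf hf0 hfint k hk => by
    refine hε.negligible_markov hf hf0 hfint (τ := fun n => n * Real.log n)
      (A := fun n => Bx * n) (fun n _ i => ‖x i‖ ^ k) (fun n _ i => by positivity) hrate ?_ ?_ ?_
    · filter_upwards [hnpos, hlogpos] with n h4 h5
      positivity
    · filter_upwards [hp hk] with n hn e _
      exact hn
    · simpa using tendsto_const_mul_div_mul_log Bx
  have hcube := hmarkov (fun u => |ψ u| ^ 3) (by fun_prop) (fun u => by positivity)
    (integrable_abs_pow_of_le (h1.comp hε0) (j := 3) (by norm_num) hmom.moment_score) 3 (by norm_num)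
  have hdsq := hmarkov (fun u => deriv ψ u ^ 2) (by fun_prop) (fun u => by positivity)
    hd1int 4 (by norm_num)
  have hddsq := hmarkov (fun u => deriv (deriv ψ) u ^ 2) (by fun_prop) (fun u => by positivity)
    (by simpa using hmom.moment_deriv2) 6 (by norm_num)
  -- One constant serves both the remainder (mean at most `Bx d₂ + K Bx`) and `score_sq` (mean at
  -- most `Bx m₂`), with 1 as allowance for the Chebyshev deviation.
  refine ⟨Bx * d₂ + Bx * m₂ + K * Bx + 1, by positivity, fun η hη => ?_⟩
  refine (((((((Negligible.iUnion hscore).union (Negligible.iUnion fun j =>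
    Negligible.iUnion (hjac η hη j))).union hrem).union hsq).union hcube).union hdsq).union
      hddsq).mono ?_
  filter_upwards [hp (k := 3) (by norm_num), hp (k := 2) (by norm_num), hsum, hnpos,
    eventually_abs_gram_sub_le hA (η := η / (2 * (|c| + 1))) (by positivity)]
    with n hn3 hn2 hnα hn0 hgram e _
  intro ω
  contrapose
  intro hω
  simp only [Set.mem_union, Set.mem_iUnion, Set.mem_ofPred_eq, not_or, not_exists, not_le] at hω
  obtain ⟨⟨⟨⟨⟨⟨g1, g2⟩, g3⟩, g4⟩, g5⟩, g6⟩, g7⟩ := hω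
  simp only [Set.mem_ofPred_eq, not_not]
  refine ⟨⟨fun j k => ?_, ?_⟩, fun j => ?_, ?_, g5.le, g6.le, g7.le⟩
  · have heq : ∑ i : Fin n, 1 * deriv ψ (firstN ε n ω i) * (x i j * x i k) - n * (c • A₁) j k =
        ∑ i : Fin n, x i j * x i k * (deriv ψ (ε i ω) - c) + c * (gram x n j k - n * A₁ j k) := by
      rw [gram_apply, Matrix.smul_apply, smul_eq_mul, mul_sub, Finset.mul_sum]
      simp only [mul_sub, Finset.sum_sub_distrib, firstN]
      have a1 : ∀ i : Fin n, 1 * deriv ψ (ε i ω) * (x i j * x i k) =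
        x i j * x i k * deriv ψ (ε i ω) := fun i => by ring
      have a2 : ∀ i : Fin n, x i j * x i k * c = c * (x i j * x i k) := fun i => by ring
      simp only [a1, a2]
      ring
    rw [heq]
    refine (abs_add_le _ _).trans ?_
    have a3 : |c * (gram x n j k - n * A₁ j k)| ≤ n * (η / 2) := by
      rw [abs_mul]
      calc _ ≤ |c| * (n * (η / (2 * (|c| + 1)))) := by gcongr; exact hgram j k
        _ = n * (η / 2) * (|c| / (|c| + 1)) := by field_simp
        _ ≤ n * (η / 2) * 1 := by
          gcongr
          exact (div_le_one (by positivity)).2 (by linarith)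
        _ = _ := mul_one _
    linarith [g2 j k]
  · have a1 := (abs_lt.1 g3).2
    simp only [mul_sub, Finset.sum_sub_distrib, ← Finset.sum_mul] at a1
    have a2 : (∑ i : Fin n, ‖x i‖ ^ 3) * d₂ ≤ Bx * n * d₂ := by gcongr
    have a3 := hnα (3 + α) (by positivity) (by linarith)
    have a4 : K * ∑ i : Fin n, ‖x i‖ ^ (3 + α) ≤ K * (Bx * n) := by gcongr
    have a5 : 0 ≤ n * (Bx * m₂) := by positivity
    simp only [abs_one, one_mul, Finset.sum_add_distrib, ← Finset.mul_sum, firstN]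
    nlinarith
  · have a1 := g1 j
    rw [hmom.centered] at a1
    simpa [firstN] using a1.le
  · have a1 := (abs_lt.1 g4).2
    simp only [mul_sub, Finset.sum_sub_distrib, ← Finset.sum_mul] at a1
    have a2 : (∑ i : Fin n, ‖x i‖ ^ 2) * m₂ ≤ Bx * n * m₂ := by gcongr
    have a5 : 0 ≤ n * (Bx * d₂ + K * Bx) := by positivity
    simp only [firstN]
    nlinarith

/-- Each sum splits into a part with centred perturbing quantities, handled by a tail bound, and the
mean of those quantities times a sum already controlled for typical errors; the stated constants add
the two contributions. -/
theorem negligible_not_nearlyLinear [IsProbabilityMeasure P] {ψ : ℝ → ℝ} {G : ℕ → Ω → ℝ}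
    {α K Bx : ℝ} (hG : IsIID P G) (hG3 : MemLp (G 0) 3 P) (hα : 0 ≤ α)
    (hsum : PowerSumBound x α Bx) {A : Matrix (Fin p) (Fin p) ℝ}
    {η B : ℝ} (hη : 0 < η) (hμ : 0 ≤ ∫ ω, G 0 ω ∂P) {Q : (n : ℕ) → Set (Fin n → ℝ)}
    (hQ : ∀ n, ∀ e ∈ Q n, TypicalErrors x ψ α K A η B e) :
    Negligible P (fun n => (√(n : ℝ))⁻¹) Q (fun n e => {ω | ¬ (
      NearlyLinear x ψ α K e (firstN G n ω) ((∫ ω, G 0 ω ∂P) • A)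
        ((1 + ∫ ω, G 0 ω ∂P) * η) (1 + (∫ ω, |G 0 ω| ∂P) * B) ∧
      ∀ j, |∑ i : Fin n, x i j * ψ (e i) * G i ω| ≤
        (variance (G 0) P * B / 2 + 1 + ∫ ω, G 0 ω ∂P) * (√n * √(Real.log n)))}) := by
  set μ := ∫ ω, G 0 ω ∂P with hμdef
  set ν := ∫ ω, |G 0 ω| ∂P with hν
  have hν0 : 0 ≤ ν := integral_nonneg fun ω => abs_nonneg _
  have hnpos : ∀ᶠ n : ℕ in atTop, (0 : ℝ) < n :=
    (eventually_gt_atTop 0).mono fun n hn => by exact_mod_cast hn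
  have hrate : ∀ᶠ n : ℕ in atTop, (0 : ℝ) < (√(n : ℝ))⁻¹ :=
    hnpos.mono fun n hn => inv_pos.2 (Real.sqrt_pos.2 hn)
  have hG2 : MemLp (G 0) 2 P := hG3.mono_exponent (by norm_num)
  have hjac : ∀ j k, Negligible P (fun n => (√(n : ℝ))⁻¹) Q (fun n e =>
      {ω | n * η ≤ |∑ i : Fin n, deriv ψ (e i) * (x i j * x i k) * (G i ω - μ)|}) := fun j k => by
    refine hG.negligible_chebyshev (f := fun u => u) measurable_id hG2 (τ := fun n => n * η)
      (A := fun n => 1 * (n * Real.log n) + 0 * n) (fun n e i => deriv ψ (e i) * (x i j * x i k))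
      hrate (hnpos.mono fun n hn => by positivity) ?_ (tendsto_mul_log_add_div_sq 1 0 η)
    refine Eventually.of_forall fun n e he => ?_
    rw [one_mul, zero_mul, add_zero]
    refine (Finset.sum_le_sum fun i _ => ?_).trans (hQ n e he).deriv_sq
    rw [mul_pow, mul_comm]
    gcongr
    exact abs_coord_mul_coord_le _ _ _
  have hrem : Negligible P (fun n => (√(n : ℝ))⁻¹) Q (fun n e =>
      {ω | (n : ℝ) ≤ |∑ i : Fin n, (‖x i‖ ^ 3 * |deriv (deriv ψ) (e i)| + K * ‖x i‖ ^ (3 + α)) *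
        (|G i ω| - ν)|}) := by
    refine hG.negligible_chebyshev (f := fun u => |u|) (by fun_prop) hG2.abs (τ := fun n => n)
      (A := fun n => 2 * (n * Real.log n) + 2 * K ^ 2 * Bx * n)
      (fun n e i => ‖x i‖ ^ 3 * |deriv (deriv ψ) (e i)| + K * ‖x i‖ ^ (3 + α)) hrate hnpos ?_
      (by simpa using tendsto_mul_log_add_div_sq 2 (2 * K ^ 2 * Bx) 1)
    filter_upwards [hsum] with n hn e he
    -- From `(a + b)² ≤ 2a² + 2b²`; here the full exponent `6 + 2 α` of the power sum bound is
    -- needed.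
    have hsq : ∀ i : Fin n, (‖x i‖ ^ 3 * |deriv (deriv ψ) (e i)| + K * ‖x i‖ ^ (3 + α)) ^ 2 ≤
        2 * (‖x i‖ ^ 6 * deriv (deriv ψ) (e i) ^ 2) + 2 * K ^ 2 * ‖x i‖ ^ (6 + 2 * α) := fun i => by
      have h1 : ‖x i‖ ^ (6 + 2 * α) = (‖x i‖ ^ (3 + α)) ^ 2 := by
        rw [← Real.rpow_natCast, ← Real.rpow_mul (norm_nonneg _)]
        congr 1; push_cast; ring
      rw [h1, ← sq_abs (deriv (deriv ψ) (e i))]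
      nlinarith [sq_nonneg (‖x i‖ ^ 3 * |deriv (deriv ψ) (e i)| - K * ‖x i‖ ^ (3 + α))]
    refine (Finset.sum_le_sum fun i _ => hsq i).trans ?_
    rw [Finset.sum_add_distrib, ← Finset.mul_sum, ← Finset.mul_sum, mul_assoc (2 * K ^ 2)]
    gcongr
    · exact (hQ n e he).deriv2_sq
    · exact hn _ (by positivity) le_rfl
  have hscore : ∀ j, Negligible P (fun n => (√(n : ℝ))⁻¹) Q (fun n e =>
      {ω | (variance (G 0) P * B / 2 + 1) * (√n * √(Real.log n)) ≤
        |∑ i : Fin n, x i j * ψ (e i) * (G i ω - μ)|}) := fun j => by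
    refine hG.negligible_moderate_deviation hG3 B (fun n e i => x i j * ψ (e i))
      (Eventually.of_forall fun n e he => ?_) (Eventually.of_forall fun n e he => ?_)
    · refine (Finset.sum_le_sum fun i _ => ?_).trans (hQ n e he).score_sq
      rw [mul_pow, ← sq_abs (x i j)]
      gcongr
      exact abs_coord_le_norm _ _
    · refine (Finset.sum_le_sum fun i _ => ?_).trans (hQ n e he).score_cube
      rw [abs_mul, mul_pow]
      gcongr
      exact abs_coord_le_norm _ _
  refine (((Negligible.iUnion fun j => Negligible.iUnion (hjac j)).union hrem).union
    (Negligible.iUnion hscore)).mono (Eventually.of_forall fun n e he => ?_)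
  have hT := hQ n e he
  intro ω
  contrapose
  intro hω
  simp only [Set.mem_union, Set.mem_iUnion, Set.mem_ofPred_eq, not_or, not_exists, not_le] at hω
  obtain ⟨⟨g1, g2⟩, g3⟩ := hω
  simp only [Set.mem_ofPred_eq, not_not]
  refine ⟨⟨fun j k => ?_, ?_⟩, fun j => ?_⟩
  · have heq : ∑ i : Fin n, firstN G n ω i * deriv ψ (e i) * (x i j * x i k) - n * (μ • A) j k =
        ∑ i : Fin n, deriv ψ (e i) * (x i j * x i k) * (G i ω - μ) +
          μ * (∑ i : Fin n, 1 * deriv ψ (e i) * (x i j * x i k) - n * A j k) := by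
      rw [Matrix.smul_apply, smul_eq_mul, mul_sub, Finset.mul_sum]
      simp only [mul_sub, Finset.sum_sub_distrib, firstN]
      have a1 : ∀ i : Fin n, G i ω * deriv ψ (e i) * (x i j * x i k) =
        deriv ψ (e i) * (x i j * x i k) * G i ω := fun i => by ring
      have a2 : ∀ i : Fin n, deriv ψ (e i) * (x i j * x i k) * μ =
        μ * (1 * deriv ψ (e i) * (x i j * x i k)) := fun i => by ring
      simp only [a1, a2]
      ring
    rw [heq]
    refine (abs_add_le _ _).trans ?_
    rw [abs_mul, abs_of_nonneg hμ]
    have a3 : μ * |∑ i : Fin n, 1 * deriv ψ (e i) * (x i j * x i k) - n * A j k| ≤ μ * (n * η) := by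
      gcongr; exact hT.nearlyLinear.jacobian j k
    linarith [g1 j k]
  · have a1 := (abs_lt.1 g2).2
    have a2 := hT.nearlyLinear.remainder
    simp only [abs_one, one_mul] at a2
    simp only [mul_sub, Finset.sum_sub_distrib, ← Finset.sum_mul] at a1
    have a3 := mul_le_mul_of_nonneg_left a2 hν0
    simp only [firstN]
    simp only [mul_comm |G _ ω|]
    linarith
  · have a1 := (g3 j).le
    have heq : ∑ i : Fin n, x i j * ψ (e i) * G i ω =
        ∑ i : Fin n, x i j * ψ (e i) * (G i ω - μ) + μ * ∑ i : Fin n, x i j * ψ (e i) := by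
      simp only [mul_sub, Finset.sum_sub_distrib, ← Finset.sum_mul]; ring
    rw [heq]
    refine (abs_add_le _ _).trans ?_
    rw [abs_mul, abs_of_nonneg hμ]
    have a3 : μ * |∑ i : Fin n, x i j * ψ (e i)| ≤ μ * (√n * √(Real.log n)) := by
      gcongr; exact hT.score j
    linarith

end Errors

/-! ### Assembly: tolerances, the good set of errors, and the final estimate -/

theorem responses_sub_inner {p n : ℕ} (x : ℕ → Vec p) (β : Vec p) (e : Fin n → ℝ) :
    (fun i : Fin n => responses x β e i - inner ℝ (x i) β) = e := by
  ext i; simp [responses]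

theorem measurable_responses {p n : ℕ} (x : ℕ → Vec p) (β : Vec p) :
    Measurable (responses x β : (Fin n → ℝ) → Fin n → ℝ) := by
  unfold responses; fun_prop

theorem norm_weightedScore_responses_le {p n : ℕ} {x : ℕ → Vec p} {ψ : ℝ → ℝ} {β : Vec p}
    {e w : Fin n → ℝ} {c : ℝ} (h : ∀ j, |∑ i : Fin n, x i j * ψ (e i) * w i| ≤ c) :
    ‖weightedScore x ψ (responses x β e) w β‖ ≤ p * c := by
  refine norm_le_of_abs_coord_le fun j => (le_of_eq ?_).trans (h j)
  congr 1
  simp only [weightedScore, responses, WithLp.ofLp_sum, Finset.sum_apply,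
    WithLp.ofLp_smul, Pi.smul_apply, smul_eq_mul, add_sub_cancel_left]
  exact Finset.sum_congr rfl fun i _ => by ring

theorem mean_pos_of_nonneg_of_nondegenerate {Ω : Type*} [MeasurableSpace Ω] {P : Measure Ω}
    {g : Ω → ℝ} (hg : Integrable g P) (h0 : ∀ᵐ ω ∂P, 0 ≤ g ω)
    (hnd : ¬ ∃ c : ℝ, ∀ᵐ ω ∂P, g ω = c) : 0 < ∫ ω, g ω ∂P := by
  refine (integral_nonneg_of_ae h0).lt_of_ne fun h => hnd ⟨0, ?_⟩
  exact (integral_eq_zero_iff_of_nonneg_ae h0 hg).1 h.symm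

theorem memLp_three_of_nonneg {Ω : Type*} [MeasurableSpace Ω] {P : Measure Ω}
    {g : Ω → ℝ} (hg : Measurable g) (h0 : ∀ᵐ ω ∂P, 0 ≤ g ω)
    (h3 : Integrable (fun ω => g ω ^ 3) P) : MemLp g 3 P := by
  rw [← integrable_norm_rpow_iff hg.aestronglyMeasurable (by norm_num) (by norm_num)]
  refine h3.congr ?_
  filter_upwards [h0] with ω hω
  rw [Real.norm_of_nonneg hω]
  norm_num

theorem measurableSet_solvesPerturbedScore_and_near {p n : ℕ} {x : ℕ → Vec p} {ψ : ℝ → ℝ}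
    (hψ : Measurable ψ) (y : Fin n → ℝ) {s : (Fin n → ℝ) → Vec p} (hs : Measurable s) (b : Vec p)
    (r : ℝ) : MeasurableSet {g | SolvesPerturbedScore x ψ y g (s g) ∧ ‖s g - b‖ ≤ r} := by
  have h1 : MeasurableSet {g | weightedScore x ψ y g (s g) = 0} :=
    (measurable_weightedScore hψ measurable_const measurable_id hs) (measurableSet_singleton 0)
  exact h1.inter (measurableSet_le (hs.sub_const b).norm measurable_const)

/-- Newton steps started at a nearby point `b` lead to a root of the perturbed score equation. -/
theorem newtonLimit_solves_and_near {p n : ℕ} {x : ℕ → Vec p} {ψ : ℝ → ℝ} {α K : ℝ}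
    (hn : 0 < n) {y w : Fin n → ℝ} {A : Matrix (Fin p) (Fin p) ℝ} (hA : IsUnit A.det)
    {η B : ℝ} {β : Vec p}
    (hα : 0 ≤ α) (hK : 0 ≤ K) (h1 : Differentiable ℝ ψ) (h2 : Differentiable ℝ (deriv ψ))
    (h3 : ∀ u v : ℝ, |deriv (deriv ψ) u - deriv (deriv ψ) v| ≤ K * |u - v| ^ α)
    (h : NearlyLinear x ψ α K (fun i => y i - inner ℝ (x i) β) w A η B)
    {ρ Λ : ℝ} (hΛ : ‖Matrix.toEuclideanCLM (𝕜 := ℝ) A⁻¹‖ ≤ Λ) (hρ0 : 0 ≤ ρ) (hρ1 : ρ ≤ 1)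
    (hsmall : Λ * (p ^ 2 * η + ρ * B) ≤ 1 / 2)
    {τ : ℝ} (hτ : ‖weightedScore x ψ y w β‖ ≤ n * τ) (hτρ : Λ * τ ≤ ρ / 2)
    {b : (Fin n → ℝ) → Vec p} (hb : ‖b y - β‖ ≤ ρ) {d : ℝ} (hd : ‖b y - β‖ ≤ d) :
    SolvesPerturbedScore x ψ y w (newtonLimit x ψ A b y w) ∧
      ‖newtonLimit x ψ A b y w - b y‖ ≤ 2 * Λ * τ + d := by
  obtain ⟨hex, hbound⟩ := h.exists_root hn hA hα hK h1 h2 h3 hΛ hρ0 hρ1 hsmall hτ hτρ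
  obtain ⟨t, ht, h0, hlim⟩ := hex (b y) (mem_closedBall_iff_norm.2 hb)
  have hnt : newtonLimit x ψ A b y w = t := hlim.limUnder_eq
  rw [hnt]
  refine ⟨solvesPerturbedScore_iff.2 h0, ?_⟩
  calc ‖t - b y‖ ≤ ‖t - β‖ + ‖b y - β‖ := by
        rw [← dist_eq_norm, ← dist_eq_norm, ← dist_eq_norm]
        exact dist_triangle_right _ _ _
    _ ≤ 2 * Λ * τ + d := add_le_add (hbound t ht h0) hd

/-- Tolerances `η` and `ρ` for which the Newton steps of both score equations are contractions. -/
theorem exists_tolerances (p : ℕ) {Λ μ B B' : ℝ} (hΛ : 0 < Λ) (hμ : 0 < μ) (hB : 0 ≤ B)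
    (hB' : 0 < B') : ∃ η ρ : ℝ, 0 < η ∧ 0 < ρ ∧ ρ ≤ 1 ∧
      Λ * (p ^ 2 * η + ρ * B) ≤ 1 / 2 ∧ Λ * (p ^ 2 * ((1 + μ) * η) + ρ * B') ≤ 1 / 2 := by
  -- The Jacobian and remainder contributions each get 1/4 of the allowed 1/2. The `+ 1` beside `p ^
  -- 2` keeps the denominator nonzero when `p = 0`.
  have hη0 : 0 < 1 / (4 * Λ * ((p : ℝ) ^ 2 + 1) * (1 + μ)) := by positivity
  obtain ⟨η, hη⟩ : ∃ η, η = 1 / (4 * Λ * ((p : ℝ) ^ 2 + 1) * (1 + μ)) := ⟨_, rfl⟩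
  rw [← hη] at hη0
  obtain ⟨ρ, hρ⟩ : ∃ ρ, ρ = min 1 (1 / (4 * Λ * (B + B'))) := ⟨_, rfl⟩
  have hD0 : 0 < B + B' := by positivity
  have hρ0 : 0 < ρ := hρ ▸ lt_min one_pos (by positivity)
  have hΛη : Λ * (p ^ 2 * ((1 + μ) * η)) ≤ 1 / 4 := by
    have h1 : Λ * (p ^ 2 * ((1 + μ) * η)) = (p : ℝ) ^ 2 / (p ^ 2 + 1) * (1 / 4) := by
      rw [hη]; field_simp
    have h2 : (p : ℝ) ^ 2 / (p ^ 2 + 1) ≤ 1 := (div_le_one (by positivity)).2 (by linarith)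
    linarith
  have hΛρ : Λ * (ρ * (B + B')) ≤ 1 / 4 := by
    have h1 : ρ ≤ 1 / (4 * Λ * (B + B')) := hρ ▸ min_le_right _ _
    calc _ ≤ Λ * (1 / (4 * Λ * (B + B')) * (B + B')) := by gcongr
      _ = 1 / 4 := by field_simp
  have e1 : Λ * (p ^ 2 * η) ≤ Λ * (p ^ 2 * ((1 + μ) * η)) := by
    gcongr; nlinarith
  have e2 : Λ * (ρ * B) ≤ Λ * (ρ * (B + B')) := by gcongr; linarith
  have e3 : Λ * (ρ * B') ≤ Λ * (ρ * (B + B')) := by gcongr; linarith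
  exact ⟨η, ρ, hη0, hρ0, hρ ▸ min_le_left _ _, by linarith, by linarith⟩

/-- The typical errors for which moreover the M-estimator is a root near the true parameter. -/
def goodErrors {p : ℕ} (x : ℕ → Vec p) (ψ : ℝ → ℝ) (α K : ℝ) (A : Matrix (Fin p) (Fin p) ℝ)
    (η B : ℝ) (β : Vec p) (ρ : ℝ) (bbar : (n : ℕ) → (Fin n → ℝ) → Vec p) (n : ℕ) :
    Set (Fin n → ℝ) :=
  {e | TypicalErrors x ψ α K A η B e} ∩
    {e | weightedScore x ψ (responses x β e) (fun _ => 1) (bbar n (responses x β e)) = 0} ∩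
    {e | ‖bbar n (responses x β e) - β‖ ≤ ρ}

theorem measurableSet_goodErrors {p : ℕ} {x : ℕ → Vec p} {ψ : ℝ → ℝ} (hψ : Measurable ψ)
    (α K : ℝ) (A : Matrix (Fin p) (Fin p) ℝ) (η B : ℝ) (β : Vec p) (ρ : ℝ)
    {bbar : (n : ℕ) → (Fin n → ℝ) → Vec p} (hb : ∀ n, Measurable (bbar n)) (n : ℕ) :
    MeasurableSet (goodErrors x ψ α K A η B β ρ bbar n) := by
  have hbr : Measurable fun e : Fin n → ℝ => bbar n (responses x β e) :=
    (hb n).comp (measurable_responses x β)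
  refine ((measurableSet_typicalErrors hψ α K A η B n).inter ?_).inter ?_
  · exact measurable_weightedScore hψ (measurable_responses x β) measurable_const hbr
      (measurableSet_singleton 0)
  · exact measurableSet_le (hbr.sub_const _).norm measurable_const

/-- For typical errors the Newton iteration supplies a root within `ρ` of `β`. If the M-estimator is
the only root, it is that one; otherwise its nearness to `β` is part of the definition. -/
theorem tendsto_measure_goodErrors {Ω : Type*} [MeasurableSpace Ω] {P : Measure Ω}
    [IsProbabilityMeasure P] {p : ℕ} {x : ℕ → Vec p} {ψ : ℝ → ℝ} {α K : ℝ}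
    {A : Matrix (Fin p) (Fin p) ℝ} (hA : IsUnit A.det) {η B ρ Λ : ℝ} {β : Vec p}
    {ε : ℕ → Ω → ℝ} {bbar : (n : ℕ) → (Fin n → ℝ) → Vec p} (hε : ∀ i, Measurable (ε i))
    (hbbar : IsMEstimator P x ψ β ε bbar)
    (hα : 0 ≤ α) (hK : 0 ≤ K) (h1 : Differentiable ℝ ψ) (h2 : Differentiable ℝ (deriv ψ))
    (h3 : ∀ u v : ℝ, |deriv (deriv ψ) u - deriv (deriv ψ) v| ≤ K * |u - v| ^ α)
    (hΛ : ‖Matrix.toEuclideanCLM (𝕜 := ℝ) A⁻¹‖ ≤ Λ) (hρ0 : 0 < ρ) (hρ1 : ρ ≤ 1)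
    (hsmall : Λ * (p ^ 2 * η + ρ * B) ≤ 1 / 2)
    (htyp : Negligible P (fun _ => 1) (fun _ => Set.univ) (fun n _ =>
      {ω | ¬ TypicalErrors x ψ α K A η B (firstN ε n ω)})) :
    Tendsto (fun n => P {ω | firstN ε n ω ∈ goodErrors x ψ α K A η B β ρ bbar n}) atTop (𝓝 1) := by
  obtain ⟨δ, hδ, hδb⟩ := htyp
  obtain ⟨hbm, hbad⟩ := hbbar
  have hbad := hbad ρ hρ0
  set bad : ℕ → Set Ω := fun n => {ω |
    ¬ (SolvesScore x ψ (responses x β (firstN ε n ω)) (bbar n (responses x β (firstN ε n ω))) ∧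
      ((∀ t, SolvesScore x ψ (responses x β (firstN ε n ω)) t →
          t = bbar n (responses x β (firstN ε n ω))) ∨
        ‖bbar n (responses x β (firstN ε n ω)) - β‖ < ρ))} with hbad_def
  set S : ℕ → Set Ω := fun n =>
    {ω | firstN ε n ω ∈ goodErrors x ψ α K A η B β ρ bbar n} with hS
  have hSm : ∀ n, MeasurableSet (S n) := fun n =>
    (measurable_pi_lambda _ fun i : Fin n => hε i)
      (measurableSet_goodErrors h1.continuous.measurable α K A η B β ρ hbm n)
  have hcompl : Tendsto (fun n => P (S n)ᶜ) atTop (𝓝 0) := by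
    have hup : Tendsto (fun n => ENNReal.ofReal (δ n) + P (bad n)) atTop (𝓝 0) := by
      have h := (ENNReal.tendsto_ofReal hδ).add hbad
      rwa [ENNReal.ofReal_zero, add_zero] at h
    refine tendsto_of_tendsto_of_tendsto_of_le_of_le' tendsto_const_nhds hup
      (Eventually.of_forall fun _ => zero_le) ?_
    have hlim := (tendsto_sqrt_mul_sqrt_log_div (Λ * p)).eventually_le_const (half_pos hρ0)
    filter_upwards [hδb, hlim, eventually_gt_atTop 0] with n hn hτ hn0
    have hn' : (0 : ℝ) < n := by exact_mod_cast hn0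
    have hsub : (S n)ᶜ ⊆ {ω | ¬ TypicalErrors x ψ α K A η B (firstN ε n ω)} ∪ bad n := by
      intro ω hω
      by_contra hcon
      rw [Set.mem_union, not_or] at hcon
      obtain ⟨c1, c2⟩ := hcon
      have c1 : TypicalErrors x ψ α K A η B (firstN ε n ω) := not_not.1 c1
      obtain ⟨c3, c4⟩ := not_not.1 c2
      refine hω ⟨⟨c1, solvesScore_iff.1 c3⟩, ?_⟩
      show ‖bbar n (responses x β (firstN ε n ω)) - β‖ ≤ ρ
      rcases c4 with huniq | hlt
      · have hnl : NearlyLinear x ψ α K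
            (fun i : Fin n => responses x β (firstN ε n ω) i - inner ℝ (x i) β) (fun _ => 1)
            A η B := by
          rw [responses_sub_inner]; exact c1.nearlyLinear
        have hnorm : ‖weightedScore x ψ (responses x β (firstN ε n ω)) (fun _ => 1) β‖ ≤
            n * (p * (√n * √(Real.log n)) / n) := by
          rw [mul_div_cancel₀ _ hn'.ne']
          exact norm_weightedScore_responses_le fun j => by simpa using c1.score j
        obtain ⟨t, ht, h0, -⟩ := (hnl.exists_root hn0 hA hα hK h1 h2 h3 hΛ hρ0.le hρ1 hsmall hnorm
          (by rw [← mul_div_assoc, ← mul_assoc]; exact hτ)).1 β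
          (Metric.mem_closedBall_self hρ0.le)
        rw [← huniq t (solvesScore_iff.2 h0)]
        exact mem_closedBall_iff_norm.1 ht
      · exact hlt.le
    refine (measure_mono hsub).trans ((measure_union_le _ _).trans (add_le_add ?_ le_rfl))
    rw [← ofReal_measureReal]
    -- The event does not depend on the conditioning vector, so any vector, here zero, may be
    -- inserted.
    exact ENNReal.ofReal_le_ofReal (by simpa using hn (fun _ => 0) (Set.mem_univ _))
  have h := ENNReal.Tendsto.sub (tendsto_const_nhds (x := (1 : ENNReal))) hcompl
    (Or.inl ENNReal.one_ne_top)
  rw [tsub_zero] at h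
  refine h.congr fun n => ?_
  rw [← prob_compl_eq_one_sub (hSm n).compl, compl_compl]

end PerturbationBootstrap

end

/-! ### The main theorem -/

open PerturbationBootstrap in
theorem proposition4p1 {Ω : Type*} [MeasurableSpace Ω] (P : Measure Ω) [IsProbabilityMeasure P]
    (p : ℕ) (x : ℕ → PerturbationBootstrap.Vec p) (β : PerturbationBootstrap.Vec p)
    (ψ : ℝ → ℝ) (α : ℝ) (ε G : ℕ → Ω → ℝ)
    (bbar : (n : ℕ) → (Fin n → ℝ) → PerturbationBootstrap.Vec p)
    -- IID errors; IID, non-negative, non-degenerate perturbing quantities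
    (hε : PerturbationBootstrap.IsIID P ε)
    (hG : PerturbationBootstrap.IsIID P G)
    (hG_nonneg : ∀ᵐ ω ∂P, 0 ≤ G 0 ω)
    (hG_nondeg : ¬ ∃ c : ℝ, ∀ᵐ ω ∂P, G 0 ω = c)
    -- the M-estimator
    (hbbar : PerturbationBootstrap.IsMEstimator P x ψ β ε bbar)
    -- smoothness of the score function
    (hα : 0 < 2 * α) (hα' : 2 * α ≤ 1)
    (hψ : PerturbationBootstrap.SmoothScore ψ α)
    -- the design vectors
    (hx : PerturbationBootstrap.DesignConditions P x ψ ε α)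
    -- moments of the errors
    (hmom : PerturbationBootstrap.ErrorMoments P ψ (ε 0))
    -- independence of the perturbing quantities and the errors
    (hindep : IndepFun (fun ω i => G i ω) (fun ω i => ε i ω) P)
    -- third moment of the perturbing quantities
    (hG3 : Integrable (fun ω => G 0 ω ^ 3) P) :
    ∃ (C₁ : ℝ) (Q : (n : ℕ) → Set (Fin n → ℝ)) (δ : ℕ → ℝ)
      (bstar : (n : ℕ) → (Fin n → ℝ) → (Fin n → ℝ) → PerturbationBootstrap.Vec p),
      0 < C₁ ∧
      (∀ n, MeasurableSet (Q n)) ∧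
      Tendsto (fun n => P {ω | PerturbationBootstrap.firstN ε n ω ∈ Q n}) atTop (𝓝 1) ∧
      Tendsto δ atTop (𝓝 0) ∧
      (∀ n, Measurable (Function.uncurry (bstar n))) ∧
      ∀ n : ℕ, C₁ ≤ (n : ℝ) → ∀ e ∈ Q n,
        1 - δ n * (n : ℝ) ^ (-(1 / 2) : ℝ) ≤
          (PerturbationBootstrap.bootstrapLaw P ε G n e).real {g |
            PerturbationBootstrap.SolvesPerturbedScore x ψ
              (PerturbationBootstrap.responses x β e) g
              (bstar n (PerturbationBootstrap.responses x β e) g) ∧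
            ‖bstar n (PerturbationBootstrap.responses x β e) g
                - bbar n (PerturbationBootstrap.responses x β e)‖
              ≤ C₁ * (n : ℝ) ^ (-(1 / 2) : ℝ) * Real.log n ^ (1 / 2 : ℝ)} := by
  have hα0 : 0 ≤ α := by linarith
  obtain ⟨h1, h2, K, h3⟩ := hψ
  have hK : 0 ≤ K := by simpa using (abs_nonneg _).trans (h3 0 1)
  have hψm : Measurable ψ := h1.continuous.measurable
  obtain ⟨A₁, hA₁pos, hA₁⟩ := hx.average
  obtain ⟨Bx, hBx, hsum⟩ := hx.sum_norm_rpow_le hα0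
  have hG3' : MemLp (G 0) 3 P := memLp_three_of_nonneg (hG.1 0) hG_nonneg hG3
  have hμ := mean_pos_of_nonneg_of_nondegenerate (hG3'.integrable (by norm_num)) hG_nonneg hG_nondeg
  obtain ⟨B, hB, htyp⟩ := negligible_not_typicalErrors hε hα0 hK hBx hψm hmom hsum hA₁
  set c := ∫ ω, deriv ψ (ε 0 ω) ∂P with hc
  -- Division by zero gives zero, so positivity of `σ²` excludes `E ψ'(ε₁) = 0`.
  have hc0 : c ≠ 0 := fun h0 => by
    have := hmom.variance_pos
    rw [← hc, h0] at this
    simp at this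
  set A := c • A₁ with hAdef
  have hA : IsUnit A.det := by
    rw [hAdef, Matrix.det_smul, isUnit_iff_ne_zero]
    exact mul_ne_zero (pow_ne_zero _ hc0) hA₁pos.det_pos.ne'
  set μ := ∫ ω, G 0 ω ∂P with hμdef
  have hA' : IsUnit (μ • A).det := by
    rw [Matrix.det_smul, isUnit_iff_ne_zero]
    exact mul_ne_zero (pow_ne_zero _ hμ.ne') hA.ne_zero
  set ν := ∫ ω, |G 0 ω| ∂P with hν
  have hν0 : 0 ≤ ν := integral_nonneg fun ω => abs_nonneg _
  -- One bound for both inverse matrices; the `+ 1` makes it positive even when `p = 0`.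
  set Λ := ‖Matrix.toEuclideanCLM (𝕜 := ℝ) A⁻¹‖ + ‖Matrix.toEuclideanCLM (𝕜 := ℝ) (μ • A)⁻¹‖ + 1
    with hΛ
  have hΛ0 : 0 < Λ := by positivity
  have hΛA : ‖Matrix.toEuclideanCLM (𝕜 := ℝ) A⁻¹‖ ≤ Λ := by
    have := norm_nonneg (Matrix.toEuclideanCLM (𝕜 := ℝ) (μ • A)⁻¹)
    linarith
  have hΛA' : ‖Matrix.toEuclideanCLM (𝕜 := ℝ) (μ • A)⁻¹‖ ≤ Λ := by
    have := norm_nonneg (Matrix.toEuclideanCLM (𝕜 := ℝ) A⁻¹)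
    linarith
  obtain ⟨η, ρ, hη0, hρ0, hρ1, hsmall, hsmall'⟩ := exists_tolerances p hΛ0 hμ hB
    (B' := 1 + ν * B) (by positivity)
  have hgood := tendsto_measure_goodErrors hA hε.1 hbbar hα0 hK h1 h2 h3 hΛA hρ0 hρ1 hsmall
    (htyp η hη0)
  set Q₀ := goodErrors x ψ α K A η B β ρ bbar with hQ₀
  -- The conditional law is determined only almost everywhere. The measurable hull of the
  -- exceptional set is still null, and removing it keeps the good sets measurable.
  set N : (n : ℕ) → Set (Fin n → ℝ) := fun n =>
    toMeasurable (P.map (firstN ε n)) {e | bootstrapLaw P ε G n e ≠ P.map (firstN G n)} with hN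
  have hεm : ∀ n, Measurable (firstN ε n) := fun n => measurable_pi_lambda _ fun i => hε.1 i
  have hGm : ∀ n, Measurable (firstN G n) := fun n => measurable_pi_lambda _ fun i => hG.1 i
  have hN0 : ∀ n, P {ω | firstN ε n ω ∈ N n} = 0 := fun n => by
    have h4 : P.map (firstN ε n) (N n) = 0 := by
      rw [hN, measure_toMeasurable]
      exact bootstrapLaw_ae_eq hε.1 hG.1 hindep n
    rwa [Measure.map_apply (hεm n) (measurableSet_toMeasurable _ _)] at h4
  obtain ⟨δ, hδ, hδb⟩ := negligible_not_nearlyLinear (K := K) hG hG3' hα0 hsum hη0 hμ.le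
    (Q := Q₀) fun n e he => he.1.1
  set C' := variance (G 0) P * B / 2 + 1 + μ with hC'
  have hV : 0 ≤ variance (G 0) P := variance_nonneg _ _
  have hC'0 : 1 ≤ C' := by
    have : 0 ≤ variance (G 0) P * B / 2 := by positivity
    linarith
  obtain ⟨n₀, hn₀⟩ := eventually_atTop.1 (hδb.and
    (((tendsto_sqrt_mul_sqrt_log_div (Λ * (p * C'))).eventually_le_const (half_pos hρ0)).and
      (eventually_gt_atTop 0)))
  -- The term `n₀` turns `C₁ ≤ n` into `n₀ ≤ n`. The last term adds the distances to `β` of the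
  -- bootstrap root (`2 Λ p C'`) and of the M-estimator (`2 Λ p`), in units of `√(log n / n)`.
  set C₁ : ℝ := n₀ + 1 + 2 * Λ * p * (C' + 1) with hC₁
  refine ⟨C₁, fun n => Q₀ n \ N n, δ, fun n => newtonLimit x ψ (μ • A) (bbar n), by positivity,
    fun n => (measurableSet_goodErrors hψm α K A η B β ρ hbbar.1 n).diff
      (measurableSet_toMeasurable _ _), ?_, hδ,
    fun n => measurable_newtonLimit hψm (μ • A) (hbbar.1 n), fun n hn e he => ?_⟩
  · refine hgood.congr fun n => ?_
    exact (measure_sdiff_null (s := {ω | firstN ε n ω ∈ Q₀ n}) (hN0 n)).symm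
  · have hnn₀ : n₀ ≤ n := by
      have h4 : 0 ≤ 2 * Λ * p * (C' + 1) := by positivity
      exact_mod_cast (show (n₀ : ℝ) ≤ n by linarith)
    obtain ⟨g1, g2, hn0⟩ := hn₀ n hnn₀
    have hn' : (0 : ℝ) < n := by exact_mod_cast hn0
    obtain ⟨⟨⟨htyp_e, hroot⟩, hnear⟩, heN⟩ := he
    have hlaw : bootstrapLaw P ε G n e = P.map (firstN G n) := by
      by_contra hne
      exact heN (subset_toMeasurable _ _ hne)
    set y := responses x β e with hy
    have hinv : (n : ℝ) ^ (-(1 / 2) : ℝ) = (√(n : ℝ))⁻¹ := by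
      rw [Real.rpow_neg hn'.le, Real.sqrt_eq_rpow]
    have hrate : ∀ c : ℝ, c * (√n * √(Real.log n)) / n = c * ((√(n : ℝ))⁻¹ * √(Real.log n)) := by
      intro c
      have hr : 0 < √(n : ℝ) := Real.sqrt_pos.2 hn'
      rw [mul_div_assoc, ← inv_mul_eq_div, ← mul_assoc]
      nth_rewrite 1 [← Real.sq_sqrt hn'.le]
      field_simp
    -- The fixed radius `ρ` is sharpened to order `√(log n / n)` by the bound valid for every root
    -- in the ball.
    have hbbar_near : ‖bbar n y - β‖ ≤ 2 * Λ * (p * (√n * √(Real.log n)) / n) := by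
      have hnl : NearlyLinear x ψ α K (fun i : Fin n => y i - inner ℝ (x i) β) (fun _ => 1)
          A η B := by
        rw [hy, responses_sub_inner]; exact htyp_e.nearlyLinear
      have hnorm : ‖weightedScore x ψ y (fun _ => 1) β‖ ≤
          n * (p * (√n * √(Real.log n)) / n) := by
        rw [mul_div_cancel₀ _ hn'.ne']
        exact norm_weightedScore_responses_le fun j => by simpa using htyp_e.score j
      refine (hnl.exists_root hn0 hA hα0 hK h1 h2 h3 hΛA hρ0.le hρ1 hsmall hnorm ?_).2 _
        (mem_closedBall_iff_norm.2 hnear) hroot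
      -- As `C' ≥ 1`, the smallness arranged for the perturbed score covers the unperturbed one as
      -- well.
      refine le_trans ?_ g2
      rw [← mul_div_assoc, ← mul_assoc]
      gcongr
      exact le_mul_of_one_le_right (by positivity) hC'0
    set T : Set (Fin n → ℝ) := {g | SolvesPerturbedScore x ψ y g
      (newtonLimit x ψ (μ • A) (bbar n) y g) ∧
      ‖newtonLimit x ψ (μ • A) (bbar n) y g - bbar n y‖ ≤
        C₁ * (n : ℝ) ^ (-(1 / 2) : ℝ) * Real.log n ^ (1 / 2 : ℝ)} with hT
    set bad : Set Ω := {ω | ¬ (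
      NearlyLinear x ψ α K e (firstN G n ω) (μ • A) ((1 + μ) * η) (1 + ν * B) ∧
      ∀ j, |∑ i : Fin n, x i j * ψ (e i) * G i ω| ≤ C' * (√n * √(Real.log n)))} with hbad
    have hsub : (firstN G n ⁻¹' T)ᶜ ⊆ bad := by
      intro ω
      contrapose
      intro hω
      obtain ⟨b1, b2⟩ := not_not.1 hω
      refine not_not.2 ?_
      show SolvesPerturbedScore x ψ y (firstN G n ω)
        (newtonLimit x ψ (μ • A) (bbar n) y (firstN G n ω)) ∧ _
      have hnl : NearlyLinear x ψ α K (fun i : Fin n => y i - inner ℝ (x i) β) (firstN G n ω)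
          (μ • A) ((1 + μ) * η) (1 + ν * B) := by
        rw [hy, responses_sub_inner]; exact b1
      have hnorm : ‖weightedScore x ψ y (firstN G n ω) β‖ ≤
          n * (p * (C' * (√n * √(Real.log n))) / n) := by
        rw [mul_div_cancel₀ _ hn'.ne']
        exact norm_weightedScore_responses_le b2
      obtain ⟨hsolve, hclose⟩ := newtonLimit_solves_and_near hn0 hA' hα0 hK h1 h2 h3 hnl hΛA'
        hρ0.le hρ1 hsmall' hnorm (le_trans (le_of_eq (by ring)) g2) hnear hbbar_near
      refine ⟨hsolve, hclose.trans ?_⟩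
      rw [hinv, ← Real.sqrt_eq_rpow, mul_assoc C₁]
      calc 2 * Λ * (p * (C' * (√n * √(Real.log n))) / n) +
            2 * Λ * (p * (√n * √(Real.log n)) / n)
          = 2 * Λ * p * (C' + 1) * (√n * √(Real.log n)) / n := by ring
        _ = 2 * Λ * p * (C' + 1) * ((√(n : ℝ))⁻¹ * √(Real.log n)) := hrate _
        _ ≤ C₁ * ((√(n : ℝ))⁻¹ * √(Real.log n)) := by
            gcongr
            have : (0 : ℝ) ≤ n₀ := Nat.cast_nonneg _
            linarith
    rw [hlaw, hinv]
    have hTm : MeasurableSet T := measurableSet_solvesPerturbedScore_and_near hψm y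
      ((measurable_newtonLimit hψm (μ • A) (hbbar.1 n)).comp measurable_prodMk_left) _ _
    rw [map_measureReal_apply (hGm n) hTm]
    have hcompl := probReal_compl_eq_one_sub (μ := P) (hGm n hTm)
    have h5 : P.real (firstN G n ⁻¹' T)ᶜ ≤ δ n * (√(n : ℝ))⁻¹ :=
      (measureReal_mono hsub).trans (g1 e ⟨⟨htyp_e, hroot⟩, hnear⟩)
    linarith
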